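/- Let $(\overline M^{2m+1},\varphi,\xi,\eta,\bar g)$ be a smooth almost contact metric manifold, i.e. $\varphi^2X=-X+\eta(X)\xi$, $\eta(\xi)=1$, $\varphi\xi=0$, $\eta=\bar g(\xi,\cdot)$ and $\bar g(\varphi X,\varphi Y)=\bar g(X,Y)-\eta(X)\eta(Y)$. Let $\overline\nabla$ be the Levi-Civita connection of $\bar g$ and $\overline R(X,Y)=[\overline\nabla_X,\overline\nabla_Y]-\overline\nabla_{[X,Y]}$ its curvature. Assume that $\overline M=\overline M^{2m+1}(c)$ is a Sasakian space form, that is, $$d\eta(X,Y)=\bar g(X,\varphi Y),\qquad(\overline\nabla_X\varphi)Y=\bar g(X,Y)\xi-\eta(Y)X$$ (with $2\,d\eta(X,Y)=X\eta(Y)-Y\eta(X)-\eta([X,Y])$), and for a constant $c\in\mathbb R$ $$\begin{aligned}\overline R(X,Y)Z={}&-\tfrac{c-1}{4}\big\{\eta(Z)[\eta(Y)X-\eta(X)Y]+[\bar g(Y,Z)\eta(X)-\bar g(X,Z)\eta(Y)]\xi\\&+\bar g(\varphi X,Z)\varphi Y+2\bar g(\varphi X,Y)\varphi Z-\bar g(\varphi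 Y,Z)\varphi X\big\}+\tfrac{c+3}{4}\{\bar g(Y,Z)X-\bar g(X,Z)Y\}.\end{aligned}$$ Assume further that the Ricci tensor $\mathsf{Ric}$ of $\bar g$ is positive definite, so that it is a Riemannian metric on $\overline M$; let $\nabla^\star$ and $R^\star$ be its Levi-Civita connection and curvature. Let $\psi:M^{2m}\to\overline M^{2m+1}(c)$ be a smooth immersion of a nonempty manifold. Let $g=\psi^*\bar g$, let $B$ be the second fundamental form of $\psi$ with respect to $\bar g$, $H=\frac1{2m}\operatorname{trace}_gB$ the mean curvature vector field, $|H|=\bar g(H,H)^{1/2}$, $\mathsf{grad}|H|$ the gradient of $|H|$ with respect to $g$, and, for a unit normal $N$ (with respect to $\bar g$), let $A$ be the Weingarten operator, $g(AX,Y)=\bar g(B(X,Y),N)$. The hypersurface is called * pseudo-Hopf if $\xi$ is tangent to $M$ and, with $V=-\varphi N$, $A$ maps $\mathsf{Span}\{\xi,V\}$ into itself at every point; * Ricci-biharmonic if $\tau_2^\star(\psi)=-\Delta^\star H-\operatorname{trace}R^\star(d\psi(\cdot),H)d\psi(\cdot)=0$, where $\Delta^\star=-\operatorname{trace}(\nabla^\star)^2$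 is the rough Laplacian on sections of $\psi^{-1}T\overline M$, and $M$ carries the metric $\psi^*\mathsf{Ric}$, which is used for both traces and, through its Levi-Civita connection, for the second covariant derivative. Then there is no such $\psi$ that is pseudo-Hopf and Ricci-biharmonic and for which $\mathsf{grad}|H|$ is a principal direction, i.e. for which $\mathsf{grad}|H|$ is at every point of $M$ an eigenvector (in particular nonzero) of $A$. -/

import Mathlib

set_option maxSynthPendingDepth 3

open scoped Manifold ContDiff Bundle

noncomputable section

namespace RicciBiharmonic

/-- The Euclidean space `ℝⁿ`, on which `n`-dimensional manifolds are modelled. -/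
abbrev Euc (n : ℕ) : Type := EuclideanSpace ℝ (Fin n)

/-- A field of bilinear forms on (an open subset of) `ℝⁿ`, the coordinate expression `G_{ij}` of
a metric in a chart. -/
abbrev FormField (n : ℕ) : Type := Euc n → Euc n →L[ℝ] Euc n →L[ℝ] ℝ

/-! ### Riemannian geometry in coordinates -/

section Local

variable {F : Type*} [NormedAddCommGroup F] [NormedSpace ℝ F]

/-- The Christoffel symbols of the first kind,
`(u, v, w) ↦ (∂_u G(v, w) + ∂_v G(u, w) - ∂_w G(u, v)) / 2`. -/
def koszul (G : F → F →L[ℝ] F →L[ℝ] ℝ) (y : F) : F →L[ℝ] F →L[ℝ] F →L[ℝ] ℝ :=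
  (1 / 2 : ℝ) • (fderiv ℝ G y + (fderiv ℝ G y).flip -
    ((ContinuousLinearMap.flipₗᵢ ℝ F F ℝ).toContinuousLinearEquiv :
      (F →L[ℝ] F →L[ℝ] ℝ) →L[ℝ] (F →L[ℝ] F →L[ℝ] ℝ)) ∘L (fderiv ℝ G y).flip)

theorem koszul_apply (G : F → F →L[ℝ] F →L[ℝ] ℝ) (y u v w : F) :
    koszul G y u v w =
      (1 / 2 : ℝ) * (fderiv ℝ G y u v w + fderiv ℝ G y v u w - fderiv ℝ G y w u v) := by
  simp [koszul]

/-- The Christoffel symbols `Γ(u, v)` of the Levi-Civita connection of `G`, characterised by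
`G(Γ(u, v), w) = koszul G u v w` when `G` is nondegenerate. -/
def christoffel (G : F → F →L[ℝ] F →L[ℝ] ℝ) (y : F) : F →L[ℝ] F →L[ℝ] F :=
  ContinuousLinearMap.compL ℝ F (F →L[ℝ] ℝ) F (G y).inverse ∘L koszul G y

/-- The curvature tensor `R(u, v)w = [∇_u, ∇_v]w - ∇_{[u, v]}w` of the Levi-Civita connection of
`G`, evaluated on constant coordinate fields. -/
def curvature (G : F → F →L[ℝ] F →L[ℝ] ℝ) (y u v w : F) : F :=
  fderiv ℝ (christoffel G) y u v w - fderiv ℝ (christoffel G) y v u w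
    + christoffel G y u (christoffel G y v w) - christoffel G y v (christoffel G y u w)

variable {k n : ℕ}

/-- The Ricci tensor `Ric(v, w) = trace (u ↦ R(u, v)w)` on vectors. -/
def ricci (G : FormField n) (y v w : Euc n) : ℝ :=
  ∑ i, curvature G y (EuclideanSpace.single i 1) v w i

/-- The Ricci tensor as a field of bilinear forms, `∑ Ric_{ij} dxⁱ ⊗ dxʲ`. -/
def ricciForm (G : FormField n) : FormField n := fun y =>
  ∑ i, ∑ j, ricci G y (EuclideanSpace.single i 1) (EuclideanSpace.single j 1) •
    (EuclideanSpace.proj i : Euc n →L[ℝ] ℝ).smulRight (EuclideanSpace.proj j : Euc n →L[ℝ] ℝ)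

/-- The trace `∑ h^{ij} S(eᵢ, eⱼ)` of `S` with respect to the inner product `h`; the vector
`h.inverse dxⁱ` is `∑ⱼ h^{ij} eⱼ`. -/
def metricTrace (h : Euc k →L[ℝ] Euc k →L[ℝ] ℝ) (S : Euc k → Euc k → Euc n) : Euc n :=
  ∑ i, S (EuclideanSpace.single i 1)
    (h.inverse (EuclideanSpace.proj i : Euc k →L[ℝ] ℝ))

/-- The metric `f^*G` induced by the map `f`. -/
def induced (G : FormField n) (f : Euc k → Euc n) : FormField k := fun x =>
  (G (f x)).bilinearComp (fderiv ℝ f x) (fderiv ℝ f x)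

/-- The covariant derivative `∇_u σ` of a vector field `σ` along `f`, in the pullback of the
Levi-Civita connection of `G`. -/
def covAlong (G : FormField n) (f σ : Euc k → Euc n) (x u : Euc k) : Euc n :=
  fderiv ℝ σ x u + christoffel G (f x) (fderiv ℝ f x u) (σ x)

/-- The second covariant derivative `∇²_{u, v} σ = ∇_u ∇_v σ - ∇_{∇_u v} σ` of a vector field along
`f`, where the source carries the Levi-Civita connection of the induced metric `f^*G`. -/
def covAlong₂ (G : FormField n) (f σ : Euc k → Euc n) (x u v : Euc k) : Euc n :=
  covAlong G f (fun z => covAlong G f σ z v) x u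
    - covAlong G f σ x (christoffel (induced G f) x u v)

/-- The rough Laplacian `Δσ = - trace ∇²σ` on vector fields along `f`. -/
def laplacian (G : FormField n) (f σ : Euc k → Euc n) (x : Euc k) : Euc n :=
  -metricTrace (induced G f x) (covAlong₂ G f σ x)

/-- The second fundamental form `B(u, v) = ∇_u (df v) - df (∇_u v)` of `f` with respect to `G` and
the induced metric. -/
def secondForm (G : FormField n) (f : Euc k → Euc n) (x : Euc k) :
    Euc k →L[ℝ] Euc k →L[ℝ] Euc n :=
  fderiv ℝ (fderiv ℝ f) x + (christoffel G (f x)).bilinearComp (fderiv ℝ f x) (fderiv ℝ f x)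
    - ContinuousLinearMap.compL ℝ (Euc k) (Euc k) (Euc n) (fderiv ℝ f x) ∘L
        christoffel (induced G f) x

/-- The mean curvature vector field `H = (1 / k) trace B`. -/
def meanCurv (G : FormField n) (f : Euc k → Euc n) (x : Euc k) : Euc n :=
  (1 / (k : ℝ)) • metricTrace (induced G f x) (fun u v => secondForm G f x u v)

/-- The length `|H|` of the mean curvature vector field. -/
def meanCurvNorm (G : FormField n) (f : Euc k → Euc n) (x : Euc k) : ℝ :=
  √(G (f x) (meanCurv G f x) (meanCurv G f x))

/-- The gradient of `|H|` with respect to the induced metric. -/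
def gradMeanCurvNorm (G : FormField n) (f : Euc k → Euc n) (x : Euc k) : Euc k :=
  (induced G f x).inverse (fderiv ℝ (meanCurvNorm G f) x)

/-- `ν` is a unit normal vector of `f` at `x`. -/
def IsUnitNormal (G : FormField n) (f : Euc k → Euc n) (x : Euc k) (ν : Euc n) : Prop :=
  (∀ u, G (f x) ν (fderiv ℝ f x u) = 0) ∧ G (f x) ν ν = 1

/-- The Weingarten operator `A` in the direction of the normal vector `ν`:
`g(A u, v) = G(B(u, v), ν)`. -/
def weingarten (G : FormField n) (f : Euc k → Euc n) (x : Euc k) (ν : Euc n) :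
    Euc k →L[ℝ] Euc k :=
  (induced G f x).inverse ∘L
    ContinuousLinearMap.compL ℝ (Euc k) (Euc n) ℝ (G (f x) ν) ∘L secondForm G f x

/-- The bitension field `τ₂* = - Δ*H - trace R*(df ·, H) df ·`, where `H` is the mean curvature
vector field with respect to `G`, while `Δ*`, `R*` and both traces belong to the isometric
immersion `f` into the space with the metric `Ric`. -/
def ricciBitension (G : FormField n) (f : Euc k → Euc n) (x : Euc k) : Euc n :=
  -laplacian (ricciForm G) f (meanCurv G f) x
    - metricTrace (induced (ricciForm G) f x) (fun u v =>
        curvature (ricciForm G) (f x) (fderiv ℝ f x u) (meanCurv G f x) (fderiv ℝ f x v))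

end Local

/-! ### Sasakian space forms -/

section Ambient

/-- An almost contact metric structure `(φ, ξ, η, g)` on a smooth manifold. The form `η` is smooth
because `η = g(ξ, ·)`. -/
structure AlmostContactMetric (n : ℕ) (N : Type*) [TopologicalSpace N] [ChartedSpace (Euc n) N]
    [IsManifold (𝓡 n) ∞ N] where
  g : Bundle.ContMDiffRiemannianMetric (𝓡 n) ∞ (Euc n) (fun x : N => TangentSpace (𝓡 n) x)
  φ : ContMDiffSection (𝓡 n) (Euc n →L[ℝ] Euc n) ∞
    (fun x : N => TangentSpace (𝓡 n) x →L[ℝ] TangentSpace (𝓡 n) x)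
  ξ : ContMDiffSection (𝓡 n) (Euc n) ∞ (fun x : N => TangentSpace (𝓡 n) x)
  η : (x : N) → TangentSpace (𝓡 n) x →L[ℝ] ℝ
  φ_φ : ∀ (x : N) (u : TangentSpace (𝓡 n) x), φ x (φ x u) = -u + η x u • ξ x
  η_ξ : ∀ x : N, η x (ξ x) = 1
  φ_ξ : ∀ x : N, φ x (ξ x) = 0
  η_eq : ∀ (x : N) (u : TangentSpace (𝓡 n) x), η x u = g.inner x (ξ x) u
  g_φ_φ : ∀ (x : N) (u v : TangentSpace (𝓡 n) x),
    g.inner x (φ x u) (φ x v) = g.inner x u v - η x u * η x v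

variable {n : ℕ} {N : Type*} [TopologicalSpace N] [ChartedSpace (Euc n) N]
  [IsManifold (𝓡 n) ∞ N]

namespace AlmostContactMetric

variable (S : AlmostContactMetric n N)

/-- The coordinate frame of the chart at `x₀`: the differential of the inverse chart. -/
def frame (x₀ : N) (y : Euc n) :
    Euc n →L[ℝ] TangentSpace (𝓡 n) ((extChartAt (𝓡 n) x₀).symm y) :=
  mfderiv 𝓘(ℝ, Euc n) (𝓡 n) (extChartAt (𝓡 n) x₀).symm y

/-- The differential of the chart at `x₀`. -/
def coframe (x₀ : N) (y : Euc n) :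
    TangentSpace (𝓡 n) ((extChartAt (𝓡 n) x₀).symm y) →L[ℝ] Euc n :=
  mfderiv (𝓡 n) 𝓘(ℝ, Euc n) (extChartAt (𝓡 n) x₀) ((extChartAt (𝓡 n) x₀).symm y)

/-- The metric in the chart at `x₀`. -/
def locG (x₀ : N) : FormField n := fun y =>
  (frame x₀ y).precomp ℝ ∘L S.g.inner ((extChartAt (𝓡 n) x₀).symm y) ∘L frame x₀ y

/-- The tensor field `φ` in the chart at `x₀`. -/
def locφ (x₀ : N) (y : Euc n) : Euc n →L[ℝ] Euc n :=
  coframe x₀ y ∘L S.φ ((extChartAt (𝓡 n) x₀).symm y) ∘L frame x₀ y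

/-- The vector field `ξ` in the chart at `x₀`. -/
def locξ (x₀ : N) (y : Euc n) : Euc n :=
  coframe x₀ y (S.ξ ((extChartAt (𝓡 n) x₀).symm y))

/-- The form `η` in the chart at `x₀`. -/
def locη (x₀ : N) (y : Euc n) : Euc n →L[ℝ] ℝ :=
  S.η ((extChartAt (𝓡 n) x₀).symm y) ∘L frame x₀ y

/-- The structure is Sasakian: `dη(u, v) = g(u, φ v)`, with the convention
`dη(u, v) = (u(η(v)) - v(η(u)) - η([u, v])) / 2`, and `(∇_u φ)v = g(u, v)ξ - η(v)u`. -/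
structure IsSasakian : Prop where
  contact : ∀ x₀ : N, ∀ y ∈ (extChartAt (𝓡 n) x₀).target, ∀ u v : Euc n,
    (1 / 2 : ℝ) * (fderiv ℝ (S.locη x₀) y u v - fderiv ℝ (S.locη x₀) y v u) =
      S.locG x₀ y u (S.locφ x₀ y v)
  sasaki : ∀ x₀ : N, ∀ y ∈ (extChartAt (𝓡 n) x₀).target, ∀ u v : Euc n,
    fderiv ℝ (S.locφ x₀) y u v + christoffel (S.locG x₀) y u (S.locφ x₀ y v)
        - S.locφ x₀ y (christoffel (S.locG x₀) y u v) =
      S.locG x₀ y u v • S.locξ x₀ y - S.locη x₀ y v • u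

/-- A Sasakian space form of constant `φ`-sectional curvature `c`. -/
structure IsSasakianSpaceForm (c : ℝ) : Prop extends IsSasakian S where
  curv : ∀ x₀ : N, ∀ y ∈ (extChartAt (𝓡 n) x₀).target, ∀ u v w : Euc n,
    let g := S.locG x₀ y
    let φ := S.locφ x₀ y
    let η := S.locη x₀ y
    let ξ := S.locξ x₀ y
    curvature (S.locG x₀) y u v w =
      -((c - 1) / 4) • (η w • (η v • u - η u • v) + (g v w * η u - g u w * η v) • ξ
          + g (φ u) w • φ v + (2 * g (φ u) v) • φ w - g (φ v) w • φ u)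
        + ((c + 3) / 4) • (g v w • u - g u w • v)

/-- The Ricci tensor is a Riemannian metric, that is, it is positive definite. -/
def RicciIsMetric : Prop :=
  ∀ x₀ : N, ∀ y ∈ (extChartAt (𝓡 n) x₀).target, ∀ u : Euc n, u ≠ 0 →
    0 < ricciForm (S.locG x₀) y u u

end AlmostContactMetric

end Ambient

/-! ### Hypersurfaces -/

section Hypersurface

variable {k n : ℕ} {N : Type*} [TopologicalSpace N] [ChartedSpace (Euc n) N]
  [IsManifold (𝓡 n) ∞ N] {M : Type*} [TopologicalSpace M] [ChartedSpace (Euc k) M]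

/-- The map `ψ` in the charts at `p₀` and `ψ p₀`. -/
def locMap (k n : ℕ) {N : Type*} [TopologicalSpace N] [ChartedSpace (Euc n) N]
    {M : Type*} [TopologicalSpace M] [ChartedSpace (Euc k) M] (ψ : M → N) (p₀ : M) :
    Euc k → Euc n :=
  writtenInExtChartAt (𝓡 k) (𝓡 n) p₀ ψ

/-- The open set of `ℝᵏ` on which `locMap k n ψ p₀` represents `ψ`. -/
def locDomain (k n : ℕ) {N : Type*} [TopologicalSpace N] [ChartedSpace (Euc n) N]
    {M : Type*} [TopologicalSpace M] [ChartedSpace (Euc k) M] (ψ : M → N) (p₀ : M) :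
    Set (Euc k) :=
  (extChartAt (𝓡 k) p₀).target ∩
    (extChartAt (𝓡 k) p₀).symm ⁻¹' (ψ ⁻¹' (extChartAt (𝓡 n) (ψ p₀)).source)

/-- A smooth map whose differential is injective at every point. -/
def IsSmoothImmersion (k n : ℕ) {N : Type*} [TopologicalSpace N] [ChartedSpace (Euc n) N]
    {M : Type*} [TopologicalSpace M] [ChartedSpace (Euc k) M] (ψ : M → N) : Prop :=
  ContMDiff (𝓡 k) (𝓡 n) ∞ ψ ∧ ∀ p, Function.Injective (mfderiv (𝓡 k) (𝓡 n) ψ p)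

/-- The immersion is Ricci-biharmonic: `τ₂* = 0`. -/
def IsRicciBiharmonic (S : AlmostContactMetric n N) (ψ : M → N) : Prop :=
  ∀ p₀ : M, ∀ x ∈ locDomain k n ψ p₀,
    ricciBitension (S.locG (ψ p₀)) (locMap k n ψ p₀) x = 0

/-- A pseudo-Hopf hypersurface: `ξ` is tangent to it, and for every unit normal `ν`, with
`V = -φν`, the Weingarten operator maps `D^⊥ = span {ξ, V}`, regarded as a subspace of the tangent
space of the hypersurface, into itself. -/
structure IsPseudoHopf (S : AlmostContactMetric n N) (ψ : M → N) : Prop where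
  tangent : ∀ p : M, S.ξ (ψ p) ∈ Set.range (mfderiv (𝓡 k) (𝓡 n) ψ p)
  invariant : ∀ p₀ : M, ∀ x ∈ locDomain k n ψ p₀, ∀ ν : Euc n,
    let G := S.locG (ψ p₀)
    let f := locMap k n ψ p₀
    IsUnitNormal G f x ν →
      let Dperp : Submodule ℝ (Euc k) :=
        (Submodule.span ℝ {S.locξ (ψ p₀) (f x), -S.locφ (ψ p₀) (f x) ν}).comap
          (fderiv ℝ f x : Euc k →ₗ[ℝ] Euc n)
      ∀ u ∈ Dperp, weingarten G f x ν u ∈ Dperp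

/-- `grad |H|` is a principal direction: at every point it is an eigenvector (in particular
nonzero) of the Weingarten operator. -/
def GradIsPrincipal (S : AlmostContactMetric n N) (ψ : M → N) : Prop :=
  ∀ p₀ : M, ∀ x ∈ locDomain k n ψ p₀, ∀ ν : Euc n,
    IsUnitNormal (S.locG (ψ p₀)) (locMap k n ψ p₀) x ν →
      ∃ μ : ℝ, Module.End.HasEigenvector
        (weingarten (S.locG (ψ p₀)) (locMap k n ψ p₀) x ν : Euc k →ₗ[ℝ] Euc k) μ
        (gradMeanCurvNorm (S.locG (ψ p₀)) (locMap k n ψ p₀) x)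

end Hypersurface

end RicciBiharmonic

end

/-!
The curvature of a Sasakian space form gives `Ric = α g + β η ⊗ η` with constants `α` and `β`.
Since `ξ` is Killing, the Christoffel symbols and the curvature of this deformation of `g` are
explicit. Write `h = |H|`, `N = H / h` and `V = -φN`. The pseudo-Hopf condition reads
`A ξ = -V`, `A V = -ξ + δ V`, and the tangential part of `τ₂* = 0` becomes
`A (grad h) - (β / α) (V h) ξ = -(k / 2) h grad h`.

By the Codazzi equation along `V`, `δ` is constant along every direction orthogonal to `V`; pairing
the tangential equation with `ξ` and `V` then gives `V h = ξ h = 0`, so wherever `grad h ≠ 0` it is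
an eigenvector of `A` with eigenvalue `l = -(k / 2) h`. The Codazzi equation applied to `grad h`
forces `l² - l δ = (c + 3) / 4`, where `c + 3 > 0`. Differentiating this identity along `grad h`
contradicts `grad h ≠ 0`. Hence `|H|` is locally constant on every pseudo-Hopf Ricci-biharmonic
hypersurface.
-/

namespace RicciBiharmonic

open scoped Topology
open Filter

/-! ### Inner products and traces -/

section InnerProduct

variable {F : Type*} [NormedAddCommGroup F] [NormedSpace ℝ F]

/-- A continuous bilinear form which is symmetric and positive definite: the value of a Riemannian
metric at a point. -/
structure IsInnerProduct (h : F →L[ℝ] F →L[ℝ] ℝ) : Prop where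
  symm : ∀ u v, h u v = h v u
  pos : ∀ u, u ≠ 0 → 0 < h u u

namespace IsInnerProduct

variable {h : F →L[ℝ] F →L[ℝ] ℝ} (hh : IsInnerProduct h)
include hh

theorem eq_zero {u : F} (hu : h u u = 0) : u = 0 :=
  by_contra fun hne => (hh.pos u hne).ne' hu

theorem nonneg (u : F) : 0 ≤ h u u := by
  rcases eq_or_ne u 0 with rfl | hu
  · simp
  · exact (hh.pos u hu).le

theorem ext {u v : F} (huv : ∀ w, h u w = h v w) : u = v :=
  sub_eq_zero.1 (hh.eq_zero (by simp [huv]))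

variable [FiniteDimensional ℝ F]

theorem isInvertible : h.IsInvertible := by
  have hinj : Function.Injective (h : F →ₗ[ℝ] F →L[ℝ] ℝ) := fun u v huv =>
    hh.ext (DFunLike.congr_fun huv)
  have hfr : Module.finrank ℝ F = Module.finrank ℝ (F →L[ℝ] ℝ) := by
    rw [← (LinearMap.toContinuousLinearMap : (F →ₗ[ℝ] ℝ) ≃ₗ[ℝ] (F →L[ℝ] ℝ)).finrank_eq]
    exact Subspace.dual_finrank_eq.symm
  exact ⟨(LinearMap.linearEquivOfInjective _ hinj hfr).toContinuousLinearEquiv, rfl⟩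

theorem apply_inverse (a : F →L[ℝ] ℝ) : h (h.inverse a) = a :=
  hh.isInvertible.self_apply_inverse a

theorem apply_inverse_right (a : F →L[ℝ] ℝ) (u : F) : h u (h.inverse a) = a u := by
  rw [hh.symm, hh.apply_inverse]

theorem apply_inverse_comm (a b : F →L[ℝ] ℝ) : a (h.inverse b) = b (h.inverse a) := by
  rw [← hh.apply_inverse_right a, hh.apply_inverse]

end IsInnerProduct

end InnerProduct

section Trace

variable {k n : ℕ}

/-- The trace `∑ h^{ij} S(eᵢ, eⱼ)` of a scalar bilinear form with respect to the inner product `h`,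
the scalar counterpart of `metricTrace`. -/
noncomputable def formTrace (h : Euc k →L[ℝ] Euc k →L[ℝ] ℝ) (S : Euc k → Euc k → ℝ) : ℝ :=
  ∑ i, S (EuclideanSpace.single i 1) (h.inverse (EuclideanSpace.proj i : Euc k →L[ℝ] ℝ))

theorem map_metricTrace (h : Euc k →L[ℝ] Euc k →L[ℝ] ℝ) (S : Euc k → Euc k → Euc n)
    (a : Euc n →L[ℝ] ℝ) : a (metricTrace h S) = formTrace h fun u v => a (S u v) :=
  map_sum a _ _

theorem clm_eq_sum {E : Type*} [NormedAddCommGroup E] [NormedSpace ℝ E] (a : Euc k →L[ℝ] E)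
    (u : Euc k) : a u = ∑ i, u i • a (EuclideanSpace.single i 1) := by
  conv_lhs => rw [← (EuclideanSpace.basisFun (Fin k) ℝ).sum_repr u]
  simp

theorem clm_trace_eq_sum (L : Euc k →L[ℝ] Euc k) :
    LinearMap.trace ℝ (Euc k) L = ∑ i, L (EuclideanSpace.single i 1) i := by
  rw [LinearMap.trace_eq_sum_inner _ (EuclideanSpace.basisFun (Fin k) ℝ)]
  simp [EuclideanSpace.inner_single_left]

theorem clm_trace_smulRight (a : Euc k →L[ℝ] ℝ) (z : Euc k) :
    LinearMap.trace ℝ (Euc k) (a.smulRight z) = a z :=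
  LinearMap.trace_smulRight _ _

variable {h : Euc k →L[ℝ] Euc k →L[ℝ] ℝ}

theorem formTrace_add (S T : Euc k → Euc k → ℝ) :
    formTrace h (fun u v => S u v + T u v) = formTrace h S + formTrace h T :=
  Finset.sum_add_distrib

theorem formTrace_sub (S T : Euc k → Euc k → ℝ) :
    formTrace h (fun u v => S u v - T u v) = formTrace h S - formTrace h T :=
  Finset.sum_sub_distrib _ _

theorem formTrace_neg (S : Euc k → Euc k → ℝ) :
    formTrace h (fun u v => -S u v) = -formTrace h S :=
  Finset.sum_neg_distrib _

theorem formTrace_mul (r : ℝ) (S : Euc k → Euc k → ℝ) :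
    formTrace h (fun u v => r * S u v) = r * formTrace h S :=
  (Finset.mul_sum _ _ _).symm

theorem formTrace_mul_apply (a b : Euc k →L[ℝ] ℝ) :
    formTrace h (fun u v => a u * b v) = b (h.inverse a) := by
  have ha : a = ∑ i, a (EuclideanSpace.single i 1) • (EuclideanSpace.proj i : Euc k →L[ℝ] ℝ) := by
    ext u
    rw [clm_eq_sum a u]
    simp [mul_comm]
  conv_rhs => rw [ha]
  simp [formTrace, map_sum]

section

variable (hh : IsInnerProduct h)
include hh

theorem formTrace_flip (S : Euc k →L[ℝ] Euc k →L[ℝ] ℝ) :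
    formTrace h (fun u v => S v u) = formTrace h fun u v => S u v := by
  have hinv : ∀ i j : Fin k, h.inverse (EuclideanSpace.proj i : Euc k →L[ℝ] ℝ) j
      = h.inverse (EuclideanSpace.proj j : Euc k →L[ℝ] ℝ) i := fun i j =>
    hh.apply_inverse_comm (EuclideanSpace.proj j) (EuclideanSpace.proj i)
  simp only [formTrace]
  have hexpand : ∀ i, S (EuclideanSpace.single i 1)
      (h.inverse (EuclideanSpace.proj i : Euc k →L[ℝ] ℝ))
      = ∑ j, h.inverse (EuclideanSpace.proj i : Euc k →L[ℝ] ℝ) j *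
        S (EuclideanSpace.single i 1) (EuclideanSpace.single j 1) := fun i =>
    clm_eq_sum (S (EuclideanSpace.single i 1)) _
  have hexpand_flip : ∀ i, S (h.inverse (EuclideanSpace.proj i : Euc k →L[ℝ] ℝ))
      (EuclideanSpace.single i 1)
      = ∑ j, h.inverse (EuclideanSpace.proj i : Euc k →L[ℝ] ℝ) j *
        S (EuclideanSpace.single j 1) (EuclideanSpace.single i 1) := fun i =>
    clm_eq_sum (S.flip (EuclideanSpace.single i 1)) _
  simp only [hexpand, hexpand_flip]
  rw [Finset.sum_comm]
  simp only [hinv]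

theorem formTrace_eq_zero_of_antisymm (S : Euc k →L[ℝ] Euc k →L[ℝ] ℝ)
    (hS : ∀ u v, S u v = -S v u) : formTrace h (fun u v => S u v) = 0 := by
  have hneg : formTrace h (fun u v => S v u) = -formTrace h fun u v => S u v := by
    rw [← formTrace_neg]
    exact congrArg _ (funext₂ fun u v => hS v u)
  linarith [formTrace_flip hh S]

theorem formTrace_inner_comp (L : Euc k →L[ℝ] Euc k) :
    formTrace h (fun u v => h (L u) v) = LinearMap.trace ℝ (Euc k) L := by
  rw [clm_trace_eq_sum]
  exact Finset.sum_congr rfl fun i _ => hh.apply_inverse_right (EuclideanSpace.proj i) _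

theorem trace_eq_zero_of_skew (L : Euc k →L[ℝ] Euc k) (hL : ∀ u v, h (L u) v = -h u (L v)) :
    LinearMap.trace ℝ (Euc k) L = 0 := by
  rw [← formTrace_inner_comp hh]
  exact formTrace_eq_zero_of_antisymm hh (h ∘L L) fun u v => by
    simp only [ContinuousLinearMap.comp_apply, hL u v, hh.symm u]

end

end Trace

/-! ### The Levi-Civita connection in coordinates -/

section Calculus

variable {E F F₁ F₂ F' : Type*} [NormedAddCommGroup E] [NormedSpace ℝ E]
  [NormedAddCommGroup F] [NormedSpace ℝ F] [NormedAddCommGroup F₁] [NormedSpace ℝ F₁]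
  [NormedAddCommGroup F₂] [NormedSpace ℝ F₂] [NormedAddCommGroup F'] [NormedSpace ℝ F'] {x : E}

theorem contDiffAt_clm_flip {m : WithTop ℕ∞} {C : E → F₁ →L[ℝ] F₂ →L[ℝ] F'}
    (hC : ContDiffAt ℝ m C x) : ContDiffAt ℝ m (fun z => (C z).flip) x :=
  (ContinuousLinearMap.flipₗᵢ ℝ F₁ F₂ F').toContinuousLinearEquiv.contDiff.contDiffAt.comp x hC

theorem contDiffAt_bilinearComp {m : WithTop ℕ∞} {B : E → F →L[ℝ] F →L[ℝ] F'}
    {L M : E → F₁ →L[ℝ] F} (hB : ContDiffAt ℝ m B x) (hL : ContDiffAt ℝ m L x)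
    (hM : ContDiffAt ℝ m M x) : ContDiffAt ℝ m (fun z => (B z).bilinearComp (L z) (M z)) x :=
  contDiffAt_clm_flip ((contDiffAt_clm_flip (hB.clm_comp hL)).clm_comp hM)

theorem fderiv_apply_field {C : E → F →L[ℝ] F'} {X : E → F} (hC : DifferentiableAt ℝ C x)
    (hX : DifferentiableAt ℝ X x) (u : E) :
    fderiv ℝ (fun z => C z (X z)) x u = fderiv ℝ C x u (X x) + C x (fderiv ℝ X x u) := by
  simp [fderiv_clm_apply hC hX, add_comm]

theorem fderiv_apply_const {C : E → F →L[ℝ] F'} (hC : DifferentiableAt ℝ C x) (u : E) (v : F) :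
    fderiv ℝ (fun z => C z v) x u = fderiv ℝ C x u v := by
  simp [fderiv_apply_field hC (differentiableAt_const v)]

theorem fderiv_apply_apply {b : E → F →L[ℝ] F →L[ℝ] F'} (hb : DifferentiableAt ℝ b x) (u : E)
    (v w : F) : fderiv ℝ (fun z => b z v w) x u = fderiv ℝ b x u v w := by
  rw [fderiv_apply_const (hb.clm_apply (differentiableAt_const v)), fderiv_apply_const hb]

theorem fderiv_symm_of_symm {b : E → F →L[ℝ] F →L[ℝ] ℝ} (hb : DifferentiableAt ℝ b x)
    (hs : ∀ᶠ z in 𝓝 x, ∀ v w, b z v w = b z w v) (u : E) (v w : F) :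
    fderiv ℝ b x u v w = fderiv ℝ b x u w v := by
  have hvw : (fun z => b z v w) =ᶠ[𝓝 x] fun z => b z w v := hs.mono fun z hz => hz v w
  rw [← fderiv_apply_apply hb, ← fderiv_apply_apply hb, hvw.fderiv_eq]

theorem two_le_infty : minSmoothness ℝ 2 ≤ (∞ : WithTop ℕ∞) := by
  simp only [minSmoothness_of_isRCLikeNormedField]
  exact WithTop.coe_le_coe.2 (le_top : (2 : ℕ∞) ≤ ⊤)

end Calculus

section LeviCivita

variable {F : Type*} [NormedAddCommGroup F] [NormedSpace ℝ F]

/-- `G` is a smooth Riemannian metric on the open set `W`. -/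
structure RiemannianOn (W : Set F) (G : F → F →L[ℝ] F →L[ℝ] ℝ) : Prop where
  isOpen : IsOpen W
  smooth : ∀ y ∈ W, ContDiffAt ℝ ∞ G y
  inner : ∀ y ∈ W, IsInnerProduct (G y)

theorem koszul_eq_of_compatible {G : F → F →L[ℝ] F →L[ℝ] ℝ} {y : F} {H : F → F → F → ℝ}
    (hsymm : ∀ u v w, H u v w = H v u w)
    (hc : ∀ u v w, fderiv ℝ G y u v w = H u v w + H u w v) (u v w : F) :
    koszul G y u v w = H u v w := by
  rw [koszul_apply, hc, hc, hc]
  linarith [hsymm u v w, hsymm u w v, hsymm v w u]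

variable {W : Set F} {G : F → F →L[ℝ] F →L[ℝ] ℝ}

namespace RiemannianOn

variable (hG : RiemannianOn W G) {y : F} (hy : y ∈ W)
include hG hy

theorem mem_nhds : W ∈ 𝓝 y := hG.isOpen.mem_nhds hy

theorem differentiableAt : DifferentiableAt ℝ G y :=
  (hG.smooth y hy).differentiableAt (by simp)

theorem fderiv_symm (u v w : F) : fderiv ℝ G y u v w = fderiv ℝ G y u w v :=
  fderiv_symm_of_symm (hG.differentiableAt hy)
    (eventually_of_mem (hG.mem_nhds hy) fun z hz => (hG.inner z hz).symm) u v w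

variable [FiniteDimensional ℝ F]

theorem inner_christoffel (u v w : F) : G y (christoffel G y u v) w = koszul G y u v w := by
  simp only [christoffel, ContinuousLinearMap.comp_apply, ContinuousLinearMap.compL_apply]
  rw [(hG.inner y hy).apply_inverse]

theorem christoffel_symm (u v : F) : christoffel G y u v = christoffel G y v u := by
  refine (hG.inner y hy).ext fun w => ?_
  rw [hG.inner_christoffel hy, hG.inner_christoffel hy, koszul_apply, koszul_apply,
    hG.fderiv_symm hy w u v]
  ring

theorem fderiv_eq (u v w : F) :
    fderiv ℝ G y u v w = G y (christoffel G y u v) w + G y v (christoffel G y u w) := by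
  rw [(hG.inner y hy).symm v, hG.inner_christoffel hy, hG.inner_christoffel hy, koszul_apply,
    koszul_apply, hG.fderiv_symm hy w u v, hG.fderiv_symm hy u w v, hG.fderiv_symm hy v u w,
    hG.fderiv_symm hy w v u]
  ring

theorem christoffel_eq_of_compatible {L : F → F → F} (hL : ∀ u v, L u v = L v u)
    (hc : ∀ u v w, fderiv ℝ G y u v w = G y (L u v) w + G y v (L u w)) (u v : F) :
    christoffel G y u v = L u v := by
  refine (hG.inner y hy).ext fun w => ?_
  rw [hG.inner_christoffel hy]
  exact koszul_eq_of_compatible (H := fun u v w => G y (L u v) w)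
    (fun u v w => by simp only [hL u v])
    (fun u v w => by rw [hc, (hG.inner y hy).symm v]) u v w

theorem contDiffAt_inverse : ContDiffAt ℝ ∞ (fun z => (G z).inverse) y := by
  obtain ⟨e, he⟩ := (hG.inner y hy).isInvertible
  have hinv : ContDiffAt ℝ ∞ ContinuousLinearMap.inverse (G y) := he ▸ contDiffAt_map_inverse e
  exact hinv.comp y (hG.smooth y hy)

theorem contDiffAt_christoffel : ContDiffAt ℝ ∞ (christoffel G) y := by
  have hdG : ContDiffAt ℝ ∞ (fderiv ℝ G) y := (hG.smooth y hy).fderiv_right (by simp)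
  have hdG_flip := contDiffAt_clm_flip hdG
  have hkoszul : ContDiffAt ℝ ∞ (koszul G) y :=
    ((hdG.add hdG_flip).sub (contDiffAt_const.clm_comp hdG_flip)).const_smul (1 / 2 : ℝ)
  exact ((ContinuousLinearMap.compL ℝ F (F →L[ℝ] ℝ) F).contDiff.contDiffAt.comp y
    (hG.contDiffAt_inverse hy)).clm_comp hkoszul

end RiemannianOn

end LeviCivita

/-! ### Immersions in coordinates -/

section Immersion

variable {k n : ℕ}

/-- `f` is a smooth immersion of the open set `U` into the open set `W`. -/
structure ImmersionOn (U : Set (Euc k)) (W : Set (Euc n)) (f : Euc k → Euc n) : Prop where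
  isOpen : IsOpen U
  smooth : ∀ x ∈ U, ContDiffAt ℝ ∞ f x
  mapsTo : ∀ x ∈ U, f x ∈ W
  injective : ∀ x ∈ U, Function.Injective (fderiv ℝ f x)

variable {U : Set (Euc k)} {W : Set (Euc n)} {f : Euc k → Euc n} {G : FormField n}

theorem ImmersionOn.mono (hf : ImmersionOn U W f) {U' : Set (Euc k)} (hU' : IsOpen U')
    (hsub : U' ⊆ U) : ImmersionOn U' W f where
  isOpen := hU'
  smooth x hx := hf.smooth x (hsub hx)
  mapsTo x hx := hf.mapsTo x (hsub hx)
  injective x hx := hf.injective x (hsub hx)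

theorem induced_apply (G : FormField n) (f : Euc k → Euc n) (x u v : Euc k) :
    induced G f x u v = G (f x) (fderiv ℝ f x u) (fderiv ℝ f x v) := rfl

theorem secondForm_apply (G : FormField n) (f : Euc k → Euc n) (x u v : Euc k) :
    secondForm G f x u v = fderiv ℝ (fderiv ℝ f) x u v
      + christoffel G (f x) (fderiv ℝ f x u) (fderiv ℝ f x v)
      - fderiv ℝ f x (christoffel (induced G f) x u v) := rfl

namespace ImmersionOn

variable (hf : ImmersionOn U W f) {x : Euc k} (hx : x ∈ U)
include hf hx

theorem mem_nhds : U ∈ 𝓝 x := hf.isOpen.mem_nhds hx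

theorem contDiffAt_fderiv : ContDiffAt ℝ ∞ (fderiv ℝ f) x :=
  (hf.smooth x hx).fderiv_right (by simp)

theorem hasFDerivAt : HasFDerivAt f (fderiv ℝ f x) x :=
  ((hf.smooth x hx).differentiableAt (by simp)).hasFDerivAt

theorem hasFDerivAt_fderiv : HasFDerivAt (fderiv ℝ f) (fderiv ℝ (fderiv ℝ f) x) x :=
  ((hf.contDiffAt_fderiv hx).differentiableAt (by simp)).hasFDerivAt

theorem fderiv_fderiv_symm (u v : Euc k) :
    fderiv ℝ (fderiv ℝ f) x u v = fderiv ℝ (fderiv ℝ f) x v u :=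
  (hf.smooth x hx).isSymmSndFDerivAt two_le_infty u v

theorem contDiffAt_fderiv_apply (u : Euc k) : ContDiffAt ℝ ∞ (fun z => fderiv ℝ f z u) x :=
  (hf.contDiffAt_fderiv hx).clm_apply contDiffAt_const

theorem covAlong_fderiv (u v : Euc k) :
    covAlong G f (fun z => fderiv ℝ f z v) x u
      = fderiv ℝ f x (christoffel (induced G f) x u v) + secondForm G f x u v := by
  rw [covAlong, secondForm_apply, fderiv_apply_const (hf.hasFDerivAt_fderiv hx).differentiableAt]
  abel

theorem fderiv_apply_ne_zero {u : Euc k} (hu : u ≠ 0) : fderiv ℝ f x u ≠ 0 :=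
  (map_ne_zero_iff _ (hf.injective x hx)).2 hu

variable (hG : RiemannianOn W G)
include hG

theorem contDiffAt_metric : ContDiffAt ℝ ∞ (fun z => G (f z)) x :=
  (hG.smooth _ (hf.mapsTo x hx)).comp x (hf.smooth x hx)

theorem contDiffAt_christoffel_comp : ContDiffAt ℝ ∞ (fun z => christoffel G (f z)) x :=
  (hG.contDiffAt_christoffel (hf.mapsTo x hx)).comp x (hf.smooth x hx)

theorem contDiffAt_covAlong {σ : Euc k → Euc n} (hσ : ContDiffAt ℝ ∞ σ x) (u : Euc k) :
    ContDiffAt ℝ ∞ (fun z => covAlong G f σ z u) x :=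
  ((hσ.fderiv_right (by simp)).clm_apply contDiffAt_const).add
    (((hf.contDiffAt_christoffel_comp hx hG).clm_apply (hf.contDiffAt_fderiv_apply hx u)).clm_apply
      hσ)

theorem fderiv_inner {σ τ : Euc k → Euc n} (hσ : DifferentiableAt ℝ σ x)
    (hτ : DifferentiableAt ℝ τ x) (u : Euc k) :
    fderiv ℝ (fun z => G (f z) (σ z) (τ z)) x u
      = G (f x) (covAlong G f σ x u) (τ x) + G (f x) (σ x) (covAlong G f τ x u) := by
  have hy := hf.mapsTo x hx
  have hGf := (hG.differentiableAt hy).hasFDerivAt.comp x (hf.hasFDerivAt hx)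
  have hinner := (hGf.clm_apply hσ.hasFDerivAt).clm_apply hτ.hasFDerivAt
  simp only [Function.comp_def] at hinner
  rw [hinner.fderiv]
  simp only [covAlong, map_add, add_apply,
    ContinuousLinearMap.coe_comp, Function.comp_apply, ContinuousLinearMap.flip_apply]
  rw [hG.fderiv_eq hy]
  ring

omit hx in
theorem riemannianOn_induced : RiemannianOn U (induced G f) where
  isOpen := hf.isOpen
  smooth _ hx := contDiffAt_bilinearComp (hf.contDiffAt_metric hx hG) (hf.contDiffAt_fderiv hx)
    (hf.contDiffAt_fderiv hx)
  inner x hx :=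
    { symm := fun _ _ => (hG.inner _ (hf.mapsTo x hx)).symm _ _
      pos := fun _ hu => (hG.inner _ (hf.mapsTo x hx)).pos _ (hf.fderiv_apply_ne_zero hx hu) }

theorem contDiffAt_secondForm : ContDiffAt ℝ ∞ (secondForm G f) x :=
  (((hf.contDiffAt_fderiv hx).fderiv_right (by simp)).add
    (contDiffAt_bilinearComp (hf.contDiffAt_christoffel_comp hx hG) (hf.contDiffAt_fderiv hx)
      (hf.contDiffAt_fderiv hx))).sub
    (((ContinuousLinearMap.compL ℝ (Euc k) (Euc k) (Euc n)).contDiff.contDiffAt.comp x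
      (hf.contDiffAt_fderiv hx)).clm_comp
        ((hf.riemannianOn_induced hG).contDiffAt_christoffel hx))

theorem secondForm_symm (u v : Euc k) : secondForm G f x u v = secondForm G f x v u := by
  rw [secondForm_apply, secondForm_apply, hf.fderiv_fderiv_symm hx u v,
    hG.christoffel_symm (hf.mapsTo x hx), (hf.riemannianOn_induced hG).christoffel_symm hx u v]

/-- The tangential part of the pullback connection is torsion-free and metric for the induced
metric, hence it is the Levi-Civita connection of the latter. -/
theorem inner_secondForm (u v w : Euc k) :
    G (f x) (secondForm G f x u v) (fderiv ℝ f x w) = 0 := by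
  have hg := hf.riemannianOn_induced hG
  have hd : ∀ v, DifferentiableAt ℝ (fun z => fderiv ℝ f z v) x := fun v =>
    (hf.contDiffAt_fderiv_apply hx v).differentiableAt (by simp)
  have hkoszul : koszul (induced G f) x u v w
      = G (f x) (covAlong G f (fun z => fderiv ℝ f z v) x u) (fderiv ℝ f x w) := by
    refine koszul_eq_of_compatible
      (H := fun u v w => G (f x) (covAlong G f (fun z => fderiv ℝ f z v) x u) (fderiv ℝ f x w))
      (fun u v w => ?_) (fun u v w => ?_) u v w
    · rw [hf.covAlong_fderiv hx, hf.covAlong_fderiv hx, hf.secondForm_symm hx hG u v,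
        hg.christoffel_symm hx u v]
    · rw [← fderiv_apply_apply (hg.differentiableAt hx)]
      simp only [induced_apply]
      rw [hf.fderiv_inner hx hG (hd v) (hd w),
        (hG.inner _ (hf.mapsTo x hx)).symm (fderiv ℝ f x v)]
  have hchristoffel := hg.inner_christoffel hx u v w
  rw [hkoszul, hf.covAlong_fderiv hx, induced_apply, map_add, add_apply] at hchristoffel
  linarith

theorem fderiv_covAlong {σ : Euc k → Euc n} (hσ : ContDiffAt ℝ ∞ σ x) (u v : Euc k) :
    fderiv ℝ (fun z => covAlong G f σ z v) x u
      = fderiv ℝ (fderiv ℝ σ) x u v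
        + (fderiv ℝ (christoffel G) (f x) (fderiv ℝ f x u) (fderiv ℝ f x v) (σ x)
          + christoffel G (f x) (fderiv ℝ (fderiv ℝ f) x u v) (σ x)
          + christoffel G (f x) (fderiv ℝ f x v) (fderiv ℝ σ x u)) := by
  have hΓ : HasFDerivAt (christoffel G) (fderiv ℝ (christoffel G) (f x)) (f x) :=
    ((hG.contDiffAt_christoffel (hf.mapsTo x hx)).differentiableAt (by simp)).hasFDerivAt
  have hdσ : HasFDerivAt (fderiv ℝ σ) (fderiv ℝ (fderiv ℝ σ) x) x :=
    ((hσ.fderiv_right (m := ∞) (by simp)).differentiableAt (by simp)).hasFDerivAt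
  have hΓσ := ((hΓ.comp x (hf.hasFDerivAt hx)).clm_apply ((hf.hasFDerivAt_fderiv hx).clm_apply
    (hasFDerivAt_const v x))).clm_apply (hσ.differentiableAt (by simp)).hasFDerivAt
  have hcov : HasFDerivAt (fun z => covAlong G f σ z v) _ x :=
    (hdσ.clm_apply (hasFDerivAt_const v x)).add hΓσ
  rw [hcov.fderiv]
  simp only [Function.comp_apply, add_apply, ContinuousLinearMap.comp_apply,
    ContinuousLinearMap.flip_apply, zero_apply, map_zero, zero_add]
  abel

theorem covAlong_commutator {σ : Euc k → Euc n} (hσ : ContDiffAt ℝ ∞ σ x) (u v : Euc k) :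
    covAlong G f (fun z => covAlong G f σ z v) x u - covAlong G f (fun z => covAlong G f σ z u) x v
      = curvature G (f x) (fderiv ℝ f x u) (fderiv ℝ f x v) (σ x) := by
  have hcov : ∀ u v, covAlong G f (fun z => covAlong G f σ z v) x u
      = fderiv ℝ (fun z => covAlong G f σ z v) x u
        + christoffel G (f x) (fderiv ℝ f x u) (covAlong G f σ x v) := fun _ _ => rfl
  rw [hcov, hcov, hf.fderiv_covAlong hx hG hσ, hf.fderiv_covAlong hx hG hσ,
    hσ.isSymmSndFDerivAt two_le_infty u v, hf.fderiv_fderiv_symm hx u v]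
  simp only [covAlong, curvature, map_add]
  abel

end ImmersionOn

end Immersion

section Forms

variable {k : ℕ}

/-- The covariant derivative `(∇_u b)(v, w)` of a field of bilinear forms with respect to the
Levi-Civita connection of `g`. -/
noncomputable def covForm (g b : FormField k) (x u v w : Euc k) : ℝ :=
  fderiv ℝ b x u v w - b x (christoffel g x u v) w - b x v (christoffel g x u w)

theorem covForm_symm {g b : FormField k} {x : Euc k} (hb : DifferentiableAt ℝ b x)
    (hs : ∀ᶠ z in 𝓝 x, ∀ u v, b z u v = b z v u) (u v w : Euc k) :
    covForm g b x u v w = covForm g b x u w v := by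
  have hsx := hs.self_of_nhds
  rw [covForm, covForm, fderiv_symm_of_symm hb hs, hsx _ w, hsx v]
  ring

theorem fderiv_trace {P : Euc k → Euc k →L[ℝ] Euc k} {x : Euc k} (hP : DifferentiableAt ℝ P x)
    (w : Euc k) : fderiv ℝ (fun z => LinearMap.trace ℝ (Euc k) (P z)) x w
      = LinearMap.trace ℝ (Euc k) (fderiv ℝ P x w) := by
  let trL : (Euc k →L[ℝ] Euc k) →L[ℝ] ℝ :=
    (LinearMap.trace ℝ (Euc k) ∘ₗ ContinuousLinearMap.coeLM ℝ).toContinuousLinearMap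
  exact congrArg (· w) (trL.hasFDerivAt.comp x hP.hasFDerivAt).fderiv

/-- The vector field dual to the form `a` with respect to the metric `g`. -/
noncomputable def sharp (g : FormField k) (a : Euc k → Euc k →L[ℝ] ℝ) (x : Euc k) : Euc k :=
  (g x).inverse (a x)

/-- The shape operator `A` of the field of bilinear forms `b`, `g(A u, v) = b(u, v)`. -/
noncomputable def shapeOperator (g b : FormField k) (x : Euc k) : Euc k →L[ℝ] Euc k :=
  (g x).inverse ∘L b x

namespace RiemannianOn

variable {U : Set (Euc k)} {g b : FormField k} (hg : RiemannianOn U g) {x : Euc k} (hx : x ∈ U)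
include hg hx

theorem inner_shapeOperator (u v : Euc k) : g x (shapeOperator g b x u) v = b x u v := by
  rw [shapeOperator, ContinuousLinearMap.comp_apply, (hg.inner x hx).apply_inverse]

theorem formTrace_eq_trace :
    formTrace (g x) (fun u v => b x u v) = LinearMap.trace ℝ (Euc k) (shapeOperator g b x) := by
  rw [← formTrace_inner_comp (hg.inner x hx)]
  simp only [hg.inner_shapeOperator hx]

theorem covForm_eq_inner (hb : ContDiffAt ℝ ∞ b x) (w u v : Euc k) :
    covForm g b x w u v = g x ((fderiv ℝ (shapeOperator g b) x w
      + (christoffel g x w ∘L shapeOperator g b x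
        - shapeOperator g b x ∘L christoffel g x w)) u) v := by
  set P : Euc k → Euc k →L[ℝ] Euc k := shapeOperator g b
  have hP : HasFDerivAt P (fderiv ℝ P x) x :=
    (((hg.contDiffAt_inverse hx).clm_comp hb).differentiableAt (by simp)).hasFDerivAt
  have hfderiv : fderiv ℝ b x w u v = fderiv ℝ g x w (P x u) v + g x (fderiv ℝ P x w u) v := by
    rw [← fderiv_apply_apply (hb.differentiableAt (by simp))]
    have hbP : (fun z => b z u v) =ᶠ[𝓝 x] fun z => g z (P z u) v :=
      eventually_of_mem (hg.mem_nhds hx) fun z hz => (hg.inner_shapeOperator hz u v).symm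
    have hgP : HasFDerivAt (fun z => g z (P z u) v) _ x :=
      ((hg.differentiableAt hx).hasFDerivAt.clm_apply
        (hP.clm_apply (hasFDerivAt_const u x))).clm_apply (hasFDerivAt_const v x)
    rw [hbP.fderiv_eq, hgP.fderiv]
    simp only [map_zero, zero_add, ContinuousLinearMap.comp_apply, add_apply,
      ContinuousLinearMap.flip_apply, zero_apply]
    ring
  rw [covForm, hfderiv, hg.fderiv_eq hx]
  simp only [add_apply, sub_apply, ContinuousLinearMap.comp_apply, map_add, map_sub, P,
    hg.inner_shapeOperator hx]
  ring

theorem formTrace_covForm (hb : ContDiffAt ℝ ∞ b x) (w : Euc k) :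
    formTrace (g x) (fun u v => covForm g b x w u v)
      = fderiv ℝ (fun z => formTrace (g z) fun u v => b z u v) x w := by
  have hP : DifferentiableAt ℝ (shapeOperator g b) x :=
    ((hg.contDiffAt_inverse hx).clm_comp hb).differentiableAt (by simp)
  have htrace : (fun z => formTrace (g z) fun u v => b z u v)
      =ᶠ[𝓝 x] fun z => LinearMap.trace ℝ (Euc k) (shapeOperator g b z) :=
    eventually_of_mem (hg.mem_nhds hx) fun z hz => hg.formTrace_eq_trace hz
  rw [htrace.fderiv_eq, fderiv_trace hP]
  simp only [hg.covForm_eq_inner hx hb]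
  rw [formTrace_inner_comp (hg.inner x hx)]
  have hcomm := LinearMap.trace_mul_comm ℝ (christoffel g x w : Euc k →ₗ[ℝ] Euc k)
    (shapeOperator g b x)
  simpa [sub_eq_zero, Module.End.mul_eq_comp, LinearMap.comp_assoc] using hcomm

end RiemannianOn

end Forms

/-! ### Hypersurfaces in coordinates -/

section Hypersurface

variable {k : ℕ}

/-- `N` is a smooth normal field of constant squared length `ρ` along `f`. -/
structure NormalOn (U : Set (Euc k)) (G : FormField (k + 1)) (f N : Euc k → Euc (k + 1)) (ρ : ℝ) :
    Prop where
  smooth : ∀ x ∈ U, ContDiffAt ℝ ∞ N x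
  normal : ∀ x ∈ U, ∀ u, G (f x) (N x) (fderiv ℝ f x u) = 0
  norm : ∀ x ∈ U, G (f x) (N x) (N x) = ρ
  pos : 0 < ρ

/-- The scalar second fundamental form `b(u, v) = G(N, B(u, v))` in the direction of the normal
field `N`. -/
noncomputable def scalarForm (G : FormField (k + 1)) (f N : Euc k → Euc (k + 1)) : FormField k :=
  fun x => ContinuousLinearMap.compL ℝ (Euc k) (Euc (k + 1)) ℝ (G (f x) (N x)) ∘L secondForm G f x

theorem scalarForm_apply (G : FormField (k + 1)) (f N : Euc k → Euc (k + 1)) (x u v : Euc k) :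
    scalarForm G f N x u v = G (f x) (N x) (secondForm G f x u v) := rfl

variable {U : Set (Euc k)} {W : Set (Euc (k + 1))} {f N : Euc k → Euc (k + 1)}
  {G : FormField (k + 1)} {ρ : ℝ}

namespace NormalOn

variable (hN : NormalOn U G f N ρ) (hf : ImmersionOn U W f) (hG : RiemannianOn W G)
  {x : Euc k} (hx : x ∈ U)

include hN hx in
theorem differentiableAt : DifferentiableAt ℝ N x := (hN.smooth x hx).differentiableAt (by simp)

include hf hG hx in
theorem scalarForm_symm (u v : Euc k) : scalarForm G f N x u v = scalarForm G f N x v u := by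
  rw [scalarForm_apply, scalarForm_apply, hf.secondForm_symm hx hG]

include hN hf hx

theorem inner_covAlong_fderiv (u v : Euc k) :
    G (f x) (N x) (covAlong G f (fun z => fderiv ℝ f z v) x u) = scalarForm G f N x u v := by
  rw [hf.covAlong_fderiv hx, map_add, hN.normal x hx, zero_add, scalarForm_apply]

theorem exists_decomp (y : Euc (k + 1)) : ∃ (u : Euc k) (t : ℝ), y = fderiv ℝ f x u + t • N x := by
  let L : (Euc k × ℝ) →ₗ[ℝ] Euc (k + 1) :=
    (fderiv ℝ f x : Euc k →ₗ[ℝ] Euc (k + 1)).coprod (LinearMap.toSpanSingleton ℝ _ (N x))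
  have hL : ∀ p, L p = fderiv ℝ f x p.1 + p.2 • N x := fun p => by simp [L]
  have hinj : Function.Injective L := by
    rw [← LinearMap.ker_eq_bot, LinearMap.ker_eq_bot']
    rintro ⟨u, t⟩ h0
    rw [hL] at h0
    have hinner := congrArg (G (f x) (N x)) h0
    simp only [map_add, hN.normal x hx, map_smul, hN.norm x hx, smul_eq_mul, map_zero,
      zero_add] at hinner
    obtain rfl : t = 0 := (mul_eq_zero.1 hinner).resolve_right hN.pos.ne'
    simp only [zero_smul, add_zero] at h0
    obtain rfl : u = 0 := hf.injective x hx (by rw [h0, map_zero])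
    rfl
  have hsurj : Function.Surjective L :=
    (LinearMap.injective_iff_surjective_of_finrank_eq_finrank (by simp)).1 hinj
  obtain ⟨p, hp⟩ := hsurj y
  exact ⟨p.1, p.2, by rw [← hp, hL]⟩

theorem exists_tangent {y : Euc (k + 1)} (hy : G (f x) (N x) y = 0) : ∃ u, fderiv ℝ f x u = y := by
  obtain ⟨u, t, rfl⟩ := hN.exists_decomp hf hx y
  simp only [map_add, hN.normal x hx, map_smul, hN.norm x hx, smul_eq_mul, zero_add] at hy
  have ht : t = 0 := (mul_eq_zero.1 hy).resolve_right hN.pos.ne'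
  exact ⟨u, by simp [ht]⟩

include hG

theorem eq_smul_of_normal {y : Euc (k + 1)} (hy : ∀ u, G (f x) y (fderiv ℝ f x u) = 0) :
    y = (G (f x) (N x) y / ρ) • N x := by
  obtain ⟨u, t, rfl⟩ := hN.exists_decomp hf hx y
  have hu : u = 0 := by
    refine ((hf.riemannianOn_induced hG).inner x hx).eq_zero ?_
    simpa [induced_apply, hN.normal x hx] using hy u
  simp [hu, hN.norm x hx, hN.pos.ne']

theorem secondForm_eq (u v : Euc k) :
    secondForm G f x u v = (scalarForm G f N x u v / ρ) • N x :=
  hN.eq_smul_of_normal hf hG hx fun w => hf.inner_secondForm hx hG u v w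

theorem contDiffAt_scalarForm : ContDiffAt ℝ ∞ (scalarForm G f N) x :=
  ((ContinuousLinearMap.compL ℝ (Euc k) (Euc (k + 1)) ℝ).contDiff.contDiffAt.comp x
    ((hf.contDiffAt_metric hx hG).clm_apply (hN.smooth x hx))).clm_comp
      (hf.contDiffAt_secondForm hx hG)

theorem inner_covAlong_self (u : Euc k) : G (f x) (covAlong G f N x u) (N x) = 0 := by
  have hleibniz := hf.fderiv_inner hx hG (hN.differentiableAt hx) (hN.differentiableAt hx) u
  have hconst : (fun z => G (f z) (N z) (N z)) =ᶠ[𝓝 x] fun _ => ρ :=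
    eventually_of_mem (hf.mem_nhds hx) hN.norm
  rw [hconst.fderiv_eq, fderiv_const_apply, zero_apply,
    (hG.inner _ (hf.mapsTo x hx)).symm (N x)] at hleibniz
  linarith

theorem inner_covAlong_tangent (u w : Euc k) :
    G (f x) (covAlong G f N x u) (fderiv ℝ f x w) = -scalarForm G f N x u w := by
  have hleibniz := hf.fderiv_inner hx hG (hN.differentiableAt hx)
    ((hf.contDiffAt_fderiv_apply hx w).differentiableAt (by simp)) u
  have hzero : (fun z => G (f z) (N z) (fderiv ℝ f z w)) =ᶠ[𝓝 x] fun _ => 0 :=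
    eventually_of_mem (hf.mem_nhds hx) fun z hz => hN.normal z hz w
  rw [hzero.fderiv_eq, fderiv_const_apply, zero_apply,
    hN.inner_covAlong_fderiv hf hx] at hleibniz
  linarith

theorem inner_covAlong_secondForm (u v w : Euc k) :
    G (f x) (covAlong G f N x u) (secondForm G f x v w) = 0 := by
  rw [hN.secondForm_eq hf hG hx, map_smul, hN.inner_covAlong_self hf hG hx, smul_zero]

theorem fderiv_scalarForm (u v w : Euc k) : fderiv ℝ (scalarForm G f N) x u v w
    = -scalarForm G f N x u (christoffel (induced G f) x v w)
      + G (f x) (N x) (covAlong G f (fun z => covAlong G f (fun z => fderiv ℝ f z w) z v) x u) := by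
  rw [← fderiv_apply_apply ((hN.contDiffAt_scalarForm hf hG hx).differentiableAt (by simp))]
  have hcov : (fun z => scalarForm G f N z v w) =ᶠ[𝓝 x]
      fun z => G (f z) (N z) (covAlong G f (fun z => fderiv ℝ f z w) z v) :=
    eventually_of_mem (hf.mem_nhds hx) fun z hz => (hN.inner_covAlong_fderiv hf hz v w).symm
  rw [hcov.fderiv_eq, hf.fderiv_inner hx hG (hN.differentiableAt hx)
    ((hf.contDiffAt_covAlong hx hG (hf.contDiffAt_fderiv_apply hx w) v).differentiableAt (by simp)),
    hf.covAlong_fderiv hx v w, map_add, hN.inner_covAlong_tangent hf hG hx,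
    hN.inner_covAlong_secondForm hf hG hx, add_zero]

theorem codazzi (u v w : Euc k) :
    covForm (induced G f) (scalarForm G f N) x u v w
        - covForm (induced G f) (scalarForm G f N) x v u w
      = G (f x) (N x)
        (curvature G (f x) (fderiv ℝ f x u) (fderiv ℝ f x v) (fderiv ℝ f x w)) := by
  rw [← hf.covAlong_commutator hx hG (hf.contDiffAt_fderiv_apply hx w) u v, map_sub, covForm,
    covForm, hN.fderiv_scalarForm hf hG hx, hN.fderiv_scalarForm hf hG hx,
    (hf.riemannianOn_induced hG).christoffel_symm hx u v]
  ring

section SmulNormal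

variable {h : Euc k → ℝ}

omit hf hG in
theorem covAlong_smul (hh : DifferentiableAt ℝ h x) (u : Euc k) :
    covAlong G f (fun z => h z • N z) x u = fderiv ℝ h x u • N x + h x • covAlong G f N x u := by
  rw [covAlong, (hh.hasFDerivAt.fun_smul (hN.differentiableAt hx).hasFDerivAt).fderiv]
  simp only [covAlong, map_smul, add_apply, smul_apply, ContinuousLinearMap.smulRight_apply,
    smul_add]
  abel

theorem inner_covAlong_smul_tangent (hh : DifferentiableAt ℝ h x) (v w : Euc k) :
    G (f x) (covAlong G f (fun z => h z • N z) x v) (fderiv ℝ f x w)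
      = -(h x * scalarForm G f N x v w) := by
  rw [hN.covAlong_smul hx hh, map_add, add_apply, map_smul, map_smul]
  simp [hN.normal x hx, hN.inner_covAlong_tangent hf hG hx]

theorem inner_covAlong_smul_secondForm (hh : DifferentiableAt ℝ h x) (u v w : Euc k) :
    G (f x) (covAlong G f (fun z => h z • N z) x u) (secondForm G f x v w)
      = fderiv ℝ h x u * scalarForm G f N x v w := by
  rw [hN.covAlong_smul hx hh, map_add, add_apply, map_smul, map_smul]
  simp [hN.inner_covAlong_secondForm hf hG hx, scalarForm_apply]

variable (hh : ∀ x ∈ U, ContDiffAt ℝ ∞ h x)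
include hh

theorem fderiv_inner_covAlong_smul (u v w : Euc k) :
    fderiv ℝ (fun z => G (f z) (covAlong G f (fun z => h z • N z) z v) (fderiv ℝ f z w)) x u
      = -(fderiv ℝ h x u * scalarForm G f N x v w
        + h x * fderiv ℝ (scalarForm G f N) x u v w) := by
  have hd : ∀ z ∈ U, DifferentiableAt ℝ h z := fun z hz => (hh z hz).differentiableAt (by simp)
  have htangent : (fun z => G (f z) (covAlong G f (fun z => h z • N z) z v) (fderiv ℝ f z w))
      =ᶠ[𝓝 x] fun z => -(h z * scalarForm G f N z v w) :=
    eventually_of_mem (hf.mem_nhds hx) fun z hz =>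
      hN.inner_covAlong_smul_tangent hf hG hz (hd z hz) v w
  have hb := (hN.contDiffAt_scalarForm hf hG hx).differentiableAt (by simp)
  have hbvw := (hb.clm_apply (differentiableAt_const v)).clm_apply (differentiableAt_const w)
  rw [htangent.fderiv_eq, fderiv_fun_neg, fderiv_fun_mul (hd x hx) hbvw, neg_apply, add_apply,
    smul_apply, smul_apply, fderiv_apply_apply hb, smul_eq_mul, smul_eq_mul]
  ring

theorem inner_covAlong₂ (u v w : Euc k) :
    G (f x) (covAlong₂ G f (fun z => h z • N z) x u v) (fderiv ℝ f x w)
      = -(fderiv ℝ h x u * scalarForm G f N x v w)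
        - h x * covForm (induced G f) (scalarForm G f N) x u v w
        - fderiv ℝ h x v * scalarForm G f N x u w := by
  have hd := (hh x hx).differentiableAt (by simp)
  have hleibniz := hf.fderiv_inner hx hG
    ((hf.contDiffAt_covAlong hx hG ((hh x hx).fun_smul (hN.smooth x hx)) v).differentiableAt
      (by simp))
    ((hf.contDiffAt_fderiv_apply hx w).differentiableAt (by simp)) u
  rw [hN.fderiv_inner_covAlong_smul hf hG hx hh, hf.covAlong_fderiv hx, map_add,
    hN.inner_covAlong_smul_tangent hf hG hx hd,
    hN.inner_covAlong_smul_secondForm hf hG hx hd] at hleibniz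
  rw [covAlong₂, map_sub, sub_apply, hN.inner_covAlong_smul_tangent hf hG hx hd, covForm]
  linarith

/-- Two summands of `∇²(h N)` have the same trace; the third is the divergence of `b`, which by
Codazzi is the derivative of the trace of `b` up to a Ricci-type term. -/
theorem inner_metricTrace_covAlong₂ (w : Euc k) :
    G (f x) (metricTrace (induced G f x) (covAlong₂ G f (fun z => h z • N z) x)) (fderiv ℝ f x w)
      = -2 * scalarForm G f N x (sharp (induced G f) (fderiv ℝ h) x) w
        - h x * fderiv ℝ (fun z => formTrace (induced G f z) fun u v => scalarForm G f N z u v) x w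
        - h x * formTrace (induced G f x) (fun u v => G (f x) (N x)
          (curvature G (f x) (fderiv ℝ f x u) (fderiv ℝ f x w) (fderiv ℝ f x v))) := by
  have hg := hf.riemannianOn_induced hG
  have hb := hN.contDiffAt_scalarForm hf hG hx
  have hcov_symm := covForm_symm (g := induced G f) (hb.differentiableAt (by simp))
    (eventually_of_mem (hf.mem_nhds hx) fun z hz => scalarForm_symm hf hG hz)
  have hcovAlong₂ : ∀ u v, G (f x) (covAlong₂ G f (fun z => h z • N z) x u v) (fderiv ℝ f x w)
      = -(fderiv ℝ h x u * (scalarForm G f N x).flip w v)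
        - h x * (covForm (induced G f) (scalarForm G f N) x w u v
          + G (f x) (N x)
            (curvature G (f x) (fderiv ℝ f x u) (fderiv ℝ f x w) (fderiv ℝ f x v)))
        - (scalarForm G f N x).flip w u * fderiv ℝ h x v := by
    intro u v
    rw [hN.inner_covAlong₂ hf hG hx hh, hcov_symm u v w, ← hN.codazzi hf hG hx u w v]
    simp only [ContinuousLinearMap.flip_apply]
    ring
  rw [(hG.inner _ (hf.mapsTo x hx)).symm, map_metricTrace]
  simp only [(hG.inner _ (hf.mapsTo x hx)).symm (fderiv ℝ f x w), hcovAlong₂]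
  rw [formTrace_sub, formTrace_sub, formTrace_neg, formTrace_mul, formTrace_add,
    formTrace_mul_apply, formTrace_mul_apply, hg.formTrace_covForm hx hb,
    (hg.inner x hx).apply_inverse_comm (fderiv ℝ h x), sharp, ContinuousLinearMap.flip_apply]
  ring

end SmulNormal

end NormalOn

end Hypersurface

/-! ### Covariant derivatives of forms and vector fields -/

section CovariantDerivative

variable {k : ℕ}

/-- The covariant derivative `∇_u X` of a vector field with respect to the Levi-Civita connection
of `g`. -/
noncomputable def covField (g : FormField k) (X : Euc k → Euc k) (x u : Euc k) : Euc k :=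
  fderiv ℝ X x u + christoffel g x u (X x)

/-- The covariant derivative `(∇_u a)(w)` of a form with respect to the Levi-Civita connection of
`g`. -/
noncomputable def covOneForm (g : FormField k) (a : Euc k → Euc k →L[ℝ] ℝ) (x u w : Euc k) : ℝ :=
  fderiv ℝ a x u w - a x (christoffel g x u w)

variable {g b : FormField k} {a a' : Euc k → Euc k →L[ℝ] ℝ} {X : Euc k → Euc k} {s : Euc k → ℝ}
  {x : Euc k}

theorem covOneForm_congr (h : a =ᶠ[𝓝 x] a') (u w : Euc k) :
    covOneForm g a x u w = covOneForm g a' x u w := by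
  rw [covOneForm, covOneForm, h.fderiv_eq, h.self_of_nhds]

theorem covOneForm_add (ha : DifferentiableAt ℝ a x) (ha' : DifferentiableAt ℝ a' x)
    (u w : Euc k) : covOneForm g (fun z => a z + a' z) x u w
      = covOneForm g a x u w + covOneForm g a' x u w := by
  rw [covOneForm, fderiv_fun_add ha ha']
  simp only [covOneForm, add_apply]
  ring

theorem covOneForm_smul (hs : DifferentiableAt ℝ s x) (ha : DifferentiableAt ℝ a x)
    (u w : Euc k) : covOneForm g (fun z => s z • a z) x u w
      = fderiv ℝ s x u * a x w + s x * covOneForm g a x u w := by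
  rw [covOneForm, fderiv_fun_smul hs ha]
  simp only [covOneForm, add_apply, smul_apply, ContinuousLinearMap.smulRight_apply, smul_eq_mul]
  ring

theorem covOneForm_neg (u w : Euc k) :
    covOneForm g (fun z => -a z) x u w = -covOneForm g a x u w := by
  rw [covOneForm, fderiv_fun_neg]
  simp only [covOneForm, neg_apply]
  ring

theorem fderiv_apply_eq_covOneForm_add (ha : DifferentiableAt ℝ a x) (hX : DifferentiableAt ℝ X x)
    (u : Euc k) : fderiv ℝ (fun z => a z (X z)) x u
      = covOneForm g a x u (X x) + a x (covField g X x u) := by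
  rw [fderiv_apply_field ha hX, covOneForm, covField, map_add]
  ring

theorem covOneForm_apply_field (hb : DifferentiableAt ℝ b x) (hX : DifferentiableAt ℝ X x)
    (u w : Euc k) : covOneForm g (fun z => b z (X z)) x u w
      = covForm g b x u (X x) w + b x (covField g X x u) w := by
  rw [covOneForm, fderiv_apply_field hb hX, covForm, covField, map_add, add_apply, add_apply]
  ring

namespace RiemannianOn

variable {U : Set (Euc k)} (hg : RiemannianOn U g) (hx : x ∈ U)
include hg hx

theorem inner_sharp (a : Euc k → Euc k →L[ℝ] ℝ) (w : Euc k) : g x (sharp g a x) w = a x w := by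
  rw [sharp, (hg.inner x hx).apply_inverse]

theorem inner_sharp_right (a : Euc k → Euc k →L[ℝ] ℝ) (w : Euc k) :
    g x w (sharp g a x) = a x w := by
  rw [(hg.inner x hx).symm, hg.inner_sharp hx]

theorem sharp_eq {v : Euc k} (hv : ∀ w, g x v w = a x w) : sharp g a x = v :=
  (hg.inner x hx).ext fun w => (hg.inner_sharp hx a w).trans (hv w).symm

theorem apply_sharp_comm (a a' : Euc k → Euc k →L[ℝ] ℝ) :
    a x (sharp g a' x) = a' x (sharp g a x) :=
  (hg.inner x hx).apply_inverse_comm _ _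

theorem sharp_ne_zero (ha : a x ≠ 0) : sharp g a x ≠ 0 := by
  contrapose! ha
  ext w
  rw [← hg.inner_sharp hx a, ha, map_zero]

theorem contDiffAt_sharp (ha : ContDiffAt ℝ ∞ a x) : ContDiffAt ℝ ∞ (sharp g a) x :=
  (hg.contDiffAt_inverse hx).clm_apply ha

theorem inner_shapeOperator_right (u w : Euc k) : g x w (shapeOperator g b x u) = b x u w := by
  rw [(hg.inner x hx).symm, hg.inner_shapeOperator hx]

theorem covOneForm_inner (hX : DifferentiableAt ℝ X x) (u w : Euc k) :
    covOneForm g (fun z => g z (X z)) x u w = g x (covField g X x u) w := by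
  have hparallel : covForm g g x u (X x) w = 0 := by
    rw [covForm, hg.fderiv_eq hx]
    ring
  rw [covOneForm_apply_field (hg.differentiableAt hx) hX, hparallel, zero_add]

theorem fderiv_inner {Y : Euc k → Euc k} (hX : DifferentiableAt ℝ X x)
    (hY : DifferentiableAt ℝ Y x) (u : Euc k) : fderiv ℝ (fun z => g z (X z) (Y z)) x u
      = g x (covField g X x u) (Y x) + g x (X x) (covField g Y x u) := by
  rw [fderiv_apply_eq_covOneForm_add (g := g) ((hg.differentiableAt hx).clm_apply hX) hY,
    hg.covOneForm_inner hx hX]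

theorem inner_covField_sharp (ha : ContDiffAt ℝ ∞ a x) (u w : Euc k) :
    g x (covField g (sharp g a) x u) w = covOneForm g a x u w := by
  have hX := (hg.contDiffAt_sharp hx ha).differentiableAt (by simp)
  have hdual : (fun z => g z (sharp g a z)) =ᶠ[𝓝 x] a := by
    filter_upwards [hg.mem_nhds hx] with z hz
    ext w
    exact hg.inner_sharp hz a w
  rw [← covOneForm_congr hdual, hg.covOneForm_inner hx hX]

theorem covOneForm_fderiv_symm (hs : ContDiffAt ℝ ∞ s x) (u w : Euc k) :
    covOneForm g (fderiv ℝ s) x u w = covOneForm g (fderiv ℝ s) x w u := by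
  rw [covOneForm, covOneForm, (hs.isSymmSndFDerivAt two_le_infty).eq u w, hg.christoffel_symm hx]

end RiemannianOn

end CovariantDerivative

/-! ### The intrinsic geometry of a pseudo-Hopf hypersurface -/

section Intrinsic

variable {k : ℕ}

/-- The coefficient `δ = b(V, V)` of the second fundamental form `b`, where `V` is the vector field
dual to the form `ν`. -/
noncomputable def coeffV (g b : FormField k) (ν : Euc k → Euc k →L[ℝ] ℝ) (x : Euc k) : ℝ :=
  b x (sharp g ν x) (sharp g ν x)

/-- The tensor fields induced on a pseudo-Hopf hypersurface of a Sasakian space form: the metric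
`g`, the second fundamental form `b`, the form `Φ(u, v) = g(φu, v)`, the forms `η = g(ξ, ·)` and
`ν = g(V, ·)`. The function `h`, a multiple of the mean curvature without critical points, solves
the tangential part of the Ricci-biharmonic equation for the metric `α g + β η ⊗ η`. -/
structure PseudoHopfData (U : Set (Euc k)) (g b Φ : FormField k) (η ν : Euc k → Euc k →L[ℝ] ℝ)
    (h : Euc k → ℝ) (c α β r : ℝ) : Prop where
  metric : RiemannianOn U g
  smooth_b : ∀ x ∈ U, ContDiffAt ℝ ∞ b x
  smooth_η : ∀ x ∈ U, ContDiffAt ℝ ∞ η x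
  smooth_ν : ∀ x ∈ U, ContDiffAt ℝ ∞ ν x
  smooth_h : ∀ x ∈ U, ContDiffAt ℝ ∞ h x
  b_symm : ∀ x ∈ U, ∀ u v, b x u v = b x v u
  Φ_skew : ∀ x ∈ U, ∀ u v, Φ x u v = -Φ x v u
  η_V : ∀ x ∈ U, η x (sharp g ν x) = 0
  ν_V : ∀ x ∈ U, ν x (sharp g ν x) = 1
  η_ζ : ∀ x ∈ U, η x (sharp g η x) = 1
  Φ_V : ∀ x ∈ U, ∀ u, Φ x u (sharp g ν x) = 0
  Φ_ζ : ∀ x ∈ U, ∀ u, Φ x u (sharp g η x) = 0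
  Φ_nondeg : ∀ x ∈ U, ∀ w, (∀ u, Φ x u w = 0) → η x w = 0 → ν x w = 0 → w = 0
  cov_η : ∀ x ∈ U, ∀ u w, covOneForm g η x u w = -Φ x u w
  cov_ν : ∀ x ∈ U, ∀ u w, covOneForm g ν x u w = Φ x (shapeOperator g b x u) w
  b_ζ : ∀ x ∈ U, ∀ w, b x (sharp g η x) w = -ν x w
  b_V : ∀ x ∈ U, ∀ w, b x (sharp g ν x) w = -η x w + coeffV g b ν x * ν x w
  codazzi : ∀ x ∈ U, ∀ u v w, covForm g b x u v w - covForm g b x v u w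
    = -((c - 1) / 4) * (Φ x u w * ν x v + 2 * Φ x u v * ν x w - Φ x v w * ν x u)
  tangential : ∀ x ∈ U, ∀ w, b x (sharp g (fderiv ℝ h) x) w
    - β / α * fderiv ℝ h x (sharp g ν x) * η x w = -(r * h x * fderiv ℝ h x w)
  h_pos : ∀ x ∈ U, 0 < h x
  h_ne : ∀ x ∈ U, fderiv ℝ h x ≠ 0
  α_pos : 0 < α
  r_pos : 0 < r
  c_pos : 0 < c + 3
  add_eq : α + β = 2 * r

namespace PseudoHopfData

variable {U : Set (Euc k)} {g b Φ : FormField k} {η ν : Euc k → Euc k →L[ℝ] ℝ}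
  {h : Euc k → ℝ} {c α β r : ℝ} (D : PseudoHopfData U g b Φ η ν h c α β r) {x : Euc k} (hx : x ∈ U)
include D hx

theorem differentiableAt_b : DifferentiableAt ℝ b x := (D.smooth_b x hx).differentiableAt (by simp)

theorem differentiableAt_η : DifferentiableAt ℝ η x := (D.smooth_η x hx).differentiableAt (by simp)

theorem differentiableAt_ν : DifferentiableAt ℝ ν x := (D.smooth_ν x hx).differentiableAt (by simp)

theorem differentiableAt_h : DifferentiableAt ℝ h x := (D.smooth_h x hx).differentiableAt (by simp)

theorem contDiffAt_V : ContDiffAt ℝ ∞ (sharp g ν) x :=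
  D.metric.contDiffAt_sharp hx (D.smooth_ν x hx)

theorem differentiableAt_V : DifferentiableAt ℝ (sharp g ν) x :=
  (D.contDiffAt_V hx).differentiableAt (by simp)

theorem differentiableAt_coeffV : DifferentiableAt ℝ (coeffV g b ν) x :=
  ((D.differentiableAt_b hx).clm_apply (D.differentiableAt_V hx)).clm_apply
    (D.differentiableAt_V hx)

theorem contDiffAt_fderiv_h : ContDiffAt ℝ ∞ (fderiv ℝ h) x :=
  (D.smooth_h x hx).fderiv_right (by simp)

theorem differentiableAt_fderiv_h : DifferentiableAt ℝ (fderiv ℝ h) x :=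
  (D.contDiffAt_fderiv_h hx).differentiableAt (by simp)

theorem inner_covField_V (u w : Euc k) :
    g x (covField g (sharp g ν) x u) w = Φ x (shapeOperator g b x u) w := by
  rw [D.metric.inner_covField_sharp hx (D.smooth_ν x hx), D.cov_ν x hx]

theorem covForm_V (u w : Euc k) :
    covForm g b x u (sharp g ν x) w
      = -Φ x (shapeOperator g b x u) (shapeOperator g b x w) + Φ x u w
        + fderiv ℝ (coeffV g b ν) x u * ν x w
        + coeffV g b ν x * Φ x (shapeOperator g b x u) w := by
  have hbV : (fun z => b z (sharp g ν z)) =ᶠ[𝓝 x] fun z => -η z + coeffV g b ν z • ν z := by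
    filter_upwards [D.metric.mem_nhds hx] with z hz
    ext w
    simpa using D.b_V z hz w
  have hleibniz := covOneForm_apply_field (g := g) (D.differentiableAt_b hx)
    (D.differentiableAt_V hx) u w
  rw [covOneForm_congr hbV, covOneForm_add (D.differentiableAt_η hx).fun_neg
    ((D.differentiableAt_coeffV hx).fun_smul (D.differentiableAt_ν hx)), covOneForm_neg,
    covOneForm_smul (D.differentiableAt_coeffV hx) (D.differentiableAt_ν hx), D.cov_η x hx,
    D.cov_ν x hx, D.b_symm x hx (covField g (sharp g ν) x u) w,
    ← D.metric.inner_shapeOperator_right (b := b) hx w, D.inner_covField_V hx] at hleibniz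
  linarith

theorem covForm_symm (u v w : Euc k) : covForm g b x u v w = covForm g b x u w v :=
  RicciBiharmonic.covForm_symm (D.differentiableAt_b hx)
    (eventually_of_mem (D.metric.mem_nhds hx) D.b_symm) u v w

/-- This is the Codazzi equation for `∇_u b` and `∇_w b`, evaluated on `V`. -/
theorem hopf_identity (u w : Euc k) :
    2 * Φ x (shapeOperator g b x u) (shapeOperator g b x w)
      = coeffV g b ν x * (Φ x (shapeOperator g b x u) w + Φ x u (shapeOperator g b x w))
        + (c + 3) / 2 * Φ x u w
        + fderiv ℝ (coeffV g b ν) x u * ν x w - fderiv ℝ (coeffV g b ν) x w * ν x u := by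
  have hcodazzi := D.codazzi x hx u w (sharp g ν x)
  rw [D.covForm_symm hx u, D.covForm_symm hx w, D.covForm_V hx, D.covForm_V hx, D.Φ_V x hx,
    D.Φ_V x hx, D.ν_V x hx, D.Φ_skew x hx (shapeOperator g b x w) (shapeOperator g b x u),
    D.Φ_skew x hx w u, D.Φ_skew x hx (shapeOperator g b x w) u] at hcodazzi
  linear_combination -hcodazzi

theorem shapeOperator_V :
    shapeOperator g b x (sharp g ν x) = -sharp g η x + coeffV g b ν x • sharp g ν x := by
  refine (D.metric.inner x hx).ext fun w => ?_
  rw [D.metric.inner_shapeOperator hx, D.b_V x hx]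
  simp [D.metric.inner_sharp hx]

theorem fderiv_coeffV (u : Euc k) : fderiv ℝ (coeffV g b ν) x u
    = fderiv ℝ (coeffV g b ν) x (sharp g ν x) * ν x u := by
  have hΦAV : ∀ v, Φ x v (shapeOperator g b x (sharp g ν x)) = 0 := fun v => by
    simp [D.shapeOperator_V hx, D.Φ_ζ x hx, D.Φ_V x hx]
  have hhopf := D.hopf_identity hx u (sharp g ν x)
  rw [hΦAV, hΦAV, D.Φ_V x hx, D.Φ_V x hx, D.ν_V x hx] at hhopf
  linarith

theorem tangential_ζ : 2 * fderiv ℝ h x (sharp g ν x)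
    = α * h x * fderiv ℝ h x (sharp g η x) := by
  have htan := D.tangential x hx (sharp g η x)
  have hα := D.α_pos.ne'
  have hβ : β = 2 * r - α := by linarith [D.add_eq]
  rw [D.η_ζ x hx, D.b_symm x hx, D.b_ζ x hx, D.metric.apply_sharp_comm hx ν, hβ] at htan
  field_simp at htan
  have hmul : r * (2 * fderiv ℝ h x (sharp g ν x) - α * h x * fderiv ℝ h x (sharp g η x)) = 0 := by
    linarith
  linarith [(mul_eq_zero.1 hmul).resolve_left D.r_pos.ne']

theorem tangential_V : -fderiv ℝ h x (sharp g η x)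
    + coeffV g b ν x * fderiv ℝ h x (sharp g ν x) = -(r * h x * fderiv ℝ h x (sharp g ν x)) := by
  have htan := D.tangential x hx (sharp g ν x)
  rw [D.η_V x hx, D.b_symm x hx, D.b_V x hx, D.metric.apply_sharp_comm hx ν,
    D.metric.apply_sharp_comm hx η] at htan
  linarith

theorem mul_coeffV_add_eq_two (hV : fderiv ℝ h x (sharp g ν x) ≠ 0) :
    α * h x * coeffV g b ν x + α * r * h x ^ 2 = 2 :=
  mul_right_cancel₀ hV (by linear_combination α * h x * D.tangential_V hx - D.tangential_ζ hx)

/-- If `V(h) ≠ 0`, then `α h δ + α r h² = 2` nearby; since `δ` is constant along `ξ`,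
differentiating along `ξ` gives `ξ(h) = 0`, which forces `V(h) = 0`. -/
theorem fderiv_h_V : fderiv ℝ h x (sharp g ν x) = 0 := by
  by_contra hne
  have hcont : ContinuousAt (fun z => fderiv ℝ h z (sharp g ν z)) x :=
    ((D.contDiffAt_fderiv_h hx).clm_apply (D.contDiffAt_V hx)).continuousAt
  have hrel : (fun z => α * h z * coeffV g b ν z + α * r * h z ^ 2) =ᶠ[𝓝 x] fun _ => 2 := by
    filter_upwards [hcont.eventually_ne hne, D.metric.mem_nhds hx] with z hz hzU
    exact D.mul_coeffV_add_eq_two hzU hz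
  have hh := (D.differentiableAt_h hx).hasFDerivAt
  have hderiv := ((hh.const_mul α).mul (D.differentiableAt_coeffV hx).hasFDerivAt).add
    ((hh.pow 2).const_mul (α * r))
  have hζ := DFunLike.congr_fun (hderiv.unique (hrel.hasFDerivAt_iff.2 (hasFDerivAt_const 2 x)))
    (sharp g η x)
  have hδζ : fderiv ℝ (coeffV g b ν) x (sharp g η x) = 0 := by
    rw [D.fderiv_coeffV hx, D.metric.apply_sharp_comm hx ν, D.η_V x hx, mul_zero]
  simp only [add_apply, smul_apply, zero_apply, smul_eq_mul, hδζ] at hζ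
  have hpos := D.h_pos x hx
  have hα := D.α_pos
  have hr := D.r_pos
  have hmul : (2 + α * r * h x ^ 2) * fderiv ℝ h x (sharp g η x) = 0 := by
    linear_combination h x * hζ
      - fderiv ℝ h x (sharp g η x) * D.mul_coeffV_add_eq_two hx hne
  have hξ := D.tangential_ζ hx
  rw [(mul_eq_zero.1 hmul).resolve_left (by positivity)] at hξ
  exact hne (by linarith)

theorem fderiv_h_ζ : fderiv ℝ h x (sharp g η x) = 0 := by
  have hζ := D.tangential_ζ hx
  rw [D.fderiv_h_V hx, mul_zero] at hζ
  exact (mul_eq_zero.1 hζ.symm).resolve_left (mul_pos D.α_pos (D.h_pos x hx)).ne'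

theorem ν_grad : ν x (sharp g (fderiv ℝ h) x) = 0 := by
  rw [D.metric.apply_sharp_comm hx, D.fderiv_h_V hx]

theorem η_grad : η x (sharp g (fderiv ℝ h) x) = 0 := by
  rw [D.metric.apply_sharp_comm hx, D.fderiv_h_ζ hx]

theorem b_grad (w : Euc k) :
    b x (sharp g (fderiv ℝ h) x) w = -(r * h x) * fderiv ℝ h x w := by
  have htan := D.tangential x hx w
  rw [D.fderiv_h_V hx] at htan
  linarith

theorem shapeOperator_grad : shapeOperator g b x (sharp g (fderiv ℝ h) x)
    = -(r * h x) • sharp g (fderiv ℝ h) x := by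
  refine (D.metric.inner x hx).ext fun w => ?_
  rw [D.metric.inner_shapeOperator hx, D.b_grad hx, map_smul, smul_apply,
    D.metric.inner_sharp hx, smul_eq_mul]

theorem covOneForm_fderiv_h_V (w : Euc k) : covOneForm g (fderiv ℝ h) x (sharp g ν x) w
    = -Φ x (shapeOperator g b x w) (sharp g (fderiv ℝ h) x) := by
  have hV : (fun z => fderiv ℝ h z (sharp g ν z)) =ᶠ[𝓝 x] fun _ => 0 :=
    eventually_of_mem (D.metric.mem_nhds hx) fun z hz => D.fderiv_h_V hz
  have hleibniz := fderiv_apply_eq_covOneForm_add (g := g) (D.differentiableAt_fderiv_h hx)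
    (D.differentiableAt_V hx) w
  rw [hV.fderiv_eq, fderiv_const_apply, zero_apply, ← D.metric.inner_sharp_right hx,
    D.inner_covField_V hx] at hleibniz
  rw [D.metric.covOneForm_fderiv_symm hx (D.smooth_h x hx)]
  linarith

/-- This is the derivative of `A(grad h) = -r h grad h` along `V`, simplified by the Codazzi
equation. -/
theorem Φ_shapeOperator_shapeOperator_grad (w : Euc k) :
    Φ x (shapeOperator g b x (shapeOperator g b x w)) (sharp g (fderiv ℝ h) x)
      = coeffV g b ν x * Φ x (shapeOperator g b x w) (sharp g (fderiv ℝ h) x)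
        + (c + 3) / 4 * Φ x w (sharp g (fderiv ℝ h) x) := by
  have hbX : (fun z => b z (sharp g (fderiv ℝ h) z)) =ᶠ[𝓝 x]
      fun z => (-(r * h z)) • fderiv ℝ h z := by
    filter_upwards [D.metric.mem_nhds hx] with z hz
    ext w
    exact D.b_grad hz w
  have hleibniz := covOneForm_apply_field (g := g) (D.differentiableAt_b hx)
    ((D.metric.contDiffAt_sharp hx (D.contDiffAt_fderiv_h hx)).differentiableAt (by simp))
    (sharp g ν x) w
  have hrh : fderiv ℝ (fun z => -(r * h z)) x (sharp g ν x) = 0 := by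
    rw [fderiv_fun_neg, fderiv_const_mul (D.differentiableAt_h hx)]
    simp [D.fderiv_h_V hx]
  rw [covOneForm_congr hbX, covOneForm_smul ((D.differentiableAt_h hx).const_mul r).fun_neg
    (D.differentiableAt_fderiv_h hx), hrh, D.covOneForm_fderiv_h_V hx,
    D.b_symm x hx (covField g (sharp g (fderiv ℝ h)) x (sharp g ν x)) w,
    ← D.metric.inner_shapeOperator_right (b := b) hx w,
    D.metric.inner_covField_sharp hx (D.contDiffAt_fderiv_h hx),
    D.covOneForm_fderiv_h_V hx] at hleibniz
  have hcodazzi := D.codazzi x hx (sharp g ν x) w (sharp g (fderiv ℝ h) x)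
  rw [D.covForm_symm hx, D.covForm_V hx, D.shapeOperator_grad hx, D.ν_V x hx, map_smul,
    D.Φ_skew x hx (sharp g ν x), D.Φ_skew x hx (sharp g ν x), D.Φ_V x hx, D.Φ_V x hx,
    D.ν_grad hx, smul_eq_mul] at hcodazzi
  linear_combination hcodazzi + hleibniz

theorem hopf_identity_grad (u : Euc k) : (-2 * (r * h x) - coeffV g b ν x)
      * Φ x (shapeOperator g b x u) (sharp g (fderiv ℝ h) x)
    = (-(r * h x) * coeffV g b ν x + (c + 3) / 2) * Φ x u (sharp g (fderiv ℝ h) x) := by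
  have hhopf := D.hopf_identity hx u (sharp g (fderiv ℝ h) x)
  rw [D.fderiv_coeffV hx (sharp g (fderiv ℝ h) x), D.ν_grad hx, D.shapeOperator_grad hx, map_smul,
    map_smul, smul_eq_mul, smul_eq_mul] at hhopf
  linear_combination hhopf

theorem exists_Φ_grad_ne_zero : ∃ u, Φ x u (sharp g (fderiv ℝ h) x) ≠ 0 := by
  by_contra! hΦ
  exact D.metric.sharp_ne_zero hx (D.h_ne x hx)
    (D.Φ_nondeg x hx _ hΦ (D.η_grad hx) (D.ν_grad hx))

/-- `u ↦ Φ(u, grad h)` is an eigenvector of the transpose of `A`, whose eigenvalue is a root of the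
quadratic `Φ_shapeOperator_shapeOperator_grad` and given by `hopf_identity_grad`. -/
theorem sq_add_mul_coeffV : (r * h x) ^ 2 + r * h x * coeffV g b ν x = (c + 3) / 4 := by
  obtain ⟨u, hu⟩ := D.exists_Φ_grad_ne_zero hx
  have hAu := D.hopf_identity_grad hx u
  have hAAu := D.hopf_identity_grad hx (shapeOperator g b x u)
  rw [D.Φ_shapeOperator_shapeOperator_grad hx u] at hAAu
  have hcp := D.c_pos
  have hmul : (coeffV g b ν x ^ 2 + (c + 3)) * ((r * h x) ^ 2 + r * h x * coeffV g b ν x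
      - (c + 3) / 4) * Φ x u (sharp g (fderiv ℝ h) x) = 0 := by
    linear_combination (-2 * (r * h x) - coeffV g b ν x) * hAAu
      + (-(r * h x * coeffV g b ν x) + (c + 3) / 2
        + (2 * (r * h x) + coeffV g b ν x) * coeffV g b ν x) * hAu
  have hzero := (mul_eq_zero.1 ((mul_eq_zero.1 hmul).resolve_right hu)).resolve_left
    (by positivity)
  linarith

theorem two_mul_add_coeffV_ne_zero : 2 * (r * h x) + coeffV g b ν x ≠ 0 := by
  intro hsum
  have hδ : coeffV g b ν x = -2 * (r * h x) := by linarith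
  have hsq := D.sq_add_mul_coeffV hx
  rw [hδ] at hsq
  nlinarith [D.c_pos, sq_nonneg (r * h x)]

omit hx in
/-- Differentiating `(r h)² + r h δ = (c + 3) / 4` along `grad h`, where `δ` is constant, would give
`(2 r h + δ) r |grad h|² = 0`. -/
theorem eq_empty : U = ∅ := by
  refine Set.eq_empty_of_forall_notMem fun x hx => ?_
  have hrel : (fun z => (r * h z) ^ 2 + r * h z * coeffV g b ν z) =ᶠ[𝓝 x] fun _ => (c + 3) / 4 :=
    eventually_of_mem (D.metric.mem_nhds hx) fun z hz => D.sq_add_mul_coeffV hz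
  have hl := (D.differentiableAt_h hx).hasFDerivAt.const_mul r
  have hderiv := (hl.pow 2).add (hl.mul (D.differentiableAt_coeffV hx).hasFDerivAt)
  have hgrad := DFunLike.congr_fun
    (hderiv.unique (hrel.hasFDerivAt_iff.2 (hasFDerivAt_const _ x))) (sharp g (fderiv ℝ h) x)
  have hδ : fderiv ℝ (coeffV g b ν) x (sharp g (fderiv ℝ h) x) = 0 := by
    rw [D.fderiv_coeffV hx, D.ν_grad hx, mul_zero]
  simp only [add_apply, smul_apply, zero_apply, smul_eq_mul, hδ] at hgrad
  have hpos : 0 < fderiv ℝ h x (sharp g (fderiv ℝ h) x) := by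
    rw [← D.metric.inner_sharp hx]
    exact (D.metric.inner x hx).pos _ (D.metric.sharp_ne_zero hx (D.h_ne x hx))
  refine (mul_ne_zero (D.two_mul_add_coeffV_ne_zero hx) (mul_pos D.r_pos hpos).ne') ?_
  linear_combination hgrad

end PseudoHopfData

end Intrinsic

/-! ### Sasakian space forms in coordinates -/

section Sasakian

variable {n : ℕ}

theorem ricci_eq_trace {G : FormField n} {y v w : Euc n} {L : Euc n →L[ℝ] Euc n}
    (hL : ∀ u, curvature G y u v w = L u) : ricci G y v w = LinearMap.trace ℝ (Euc n) L := by
  simp only [clm_trace_eq_sum, ricci, hL]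

theorem ricciForm_eq_of_ricci_eq {G : FormField n} {y : Euc n} {B : Euc n →L[ℝ] Euc n →L[ℝ] ℝ}
    (hB : ∀ v w, ricci G y v w = B v w) : ricciForm G y = B := by
  ext v w
  conv_rhs => rw [clm_eq_sum B v]
  simp only [ricciForm, hB, sum_apply, smul_apply, clm_eq_sum (B _) w, Finset.smul_sum]
  refine Finset.sum_congr rfl fun i _ => Finset.sum_congr rfl fun j _ => ?_
  simp only [ContinuousLinearMap.smulRight_apply, smul_apply, smul_eq_mul, PiLp.proj_apply]
  ring

/-- The coordinate expression of a Sasakian space form on the open set `W`. -/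
structure SasakianOn (W : Set (Euc n)) (G : FormField n) (φ : Euc n → Euc n →L[ℝ] Euc n)
    (ξ : Euc n → Euc n) (η : Euc n → Euc n →L[ℝ] ℝ) (c : ℝ) : Prop where
  metric : RiemannianOn W G
  smooth_φ : ∀ y ∈ W, ContDiffAt ℝ ∞ φ y
  smooth_ξ : ∀ y ∈ W, ContDiffAt ℝ ∞ ξ y
  φ_φ : ∀ y ∈ W, ∀ u, φ y (φ y u) = -u + η y u • ξ y
  η_ξ : ∀ y ∈ W, η y (ξ y) = 1
  φ_ξ : ∀ y ∈ W, φ y (ξ y) = 0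
  η_eq : ∀ y ∈ W, ∀ u, η y u = G y (ξ y) u
  G_φ_φ : ∀ y ∈ W, ∀ u v, G y (φ y u) (φ y v) = G y u v - η y u * η y v
  sasaki : ∀ y ∈ W, ∀ u v, fderiv ℝ φ y u v + christoffel G y u (φ y v)
    - φ y (christoffel G y u v) = G y u v • ξ y - η y v • u
  curv : ∀ y ∈ W, ∀ u v w, curvature G y u v w =
    -((c - 1) / 4) • (η y w • (η y v • u - η y u • v)
        + (G y v w * η y u - G y u w * η y v) • ξ y
        + G y (φ y u) w • φ y v + (2 * G y (φ y u) v) • φ y w - G y (φ y v) w • φ y u)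
      + ((c + 3) / 4) • (G y v w • u - G y u w • v)

/-- The coefficient of the metric `g` in the Ricci tensor of a Sasakian space form of constant
`φ`-sectional curvature `c` and dimension `n`. -/
noncomputable def ricciMetricCoeff (n : ℕ) (c : ℝ) : ℝ := (c - 1) / 2 + (n - 1) * (c + 3) / 4

/-- The coefficient of `η ⊗ η` in the Ricci tensor of a Sasakian space form of constant
`φ`-sectional curvature `c` and dimension `n`. -/
noncomputable def ricciContactCoeff (n : ℕ) (c : ℝ) : ℝ := -((c - 1) * (n + 1) / 4)

theorem ricciMetricCoeff_add_ricciContactCoeff (n : ℕ) (c : ℝ) :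
    ricciMetricCoeff n c + ricciContactCoeff n c = n - 1 := by
  rw [ricciMetricCoeff, ricciContactCoeff]
  ring

namespace SasakianOn

variable {W : Set (Euc n)} {G : FormField n} {φ : Euc n → Euc n →L[ℝ] Euc n}
  {ξ : Euc n → Euc n} {η : Euc n → Euc n →L[ℝ] ℝ} {c : ℝ} (S : SasakianOn W G φ ξ η c)
  {y : Euc n} (hy : y ∈ W)
include S hy

theorem η_φ (u : Euc n) : η y (φ y u) = 0 := by
  have hφφφ := S.φ_φ y hy (φ y u)
  rw [S.φ_φ y hy u, map_add, map_neg, map_smul, S.φ_ξ y hy, smul_zero, add_zero,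
    left_eq_add] at hφφφ
  simpa [S.η_ξ y hy] using congrArg (η y) hφφφ

theorem inner_ξ (u : Euc n) : G y u (ξ y) = η y u := by
  rw [S.η_eq y hy, (S.metric.inner y hy).symm]

theorem φ_skew (u v : Euc n) : G y (φ y u) v = -G y u (φ y v) := by
  have hφφ := S.G_φ_φ y hy u (φ y v)
  rw [S.φ_φ y hy, map_add, map_neg, map_smul, S.inner_ξ hy, S.η_φ hy, S.η_φ hy, smul_zero,
    mul_zero, add_zero, sub_zero] at hφφ
  rw [← hφφ, neg_neg]

theorem inner_φ_self (u : Euc n) : G y u (φ y u) = 0 := by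
  have hskew := S.φ_skew hy u u
  rw [(S.metric.inner y hy).symm] at hskew
  linarith

theorem η_eventuallyEq : η =ᶠ[𝓝 y] fun z => G z (ξ z) :=
  eventually_of_mem (S.metric.mem_nhds hy) fun z hz => ContinuousLinearMap.ext (S.η_eq z hz)

theorem contDiffAt_η : ContDiffAt ℝ ∞ η y :=
  ((S.metric.smooth y hy).clm_apply (S.smooth_ξ y hy)).congr_of_eventuallyEq (S.η_eventuallyEq hy)

theorem differentiableAt_φ : DifferentiableAt ℝ φ y := (S.smooth_φ y hy).differentiableAt (by simp)

theorem differentiableAt_ξ : DifferentiableAt ℝ ξ y := (S.smooth_ξ y hy).differentiableAt (by simp)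

theorem differentiableAt_η : DifferentiableAt ℝ η y :=
  (S.contDiffAt_η hy).differentiableAt (by simp)

theorem fderiv_φ (u v : Euc n) : fderiv ℝ φ y u v
    = G y u v • ξ y - η y v • u - christoffel G y u (φ y v) + φ y (christoffel G y u v) := by
  rw [← S.sasaki y hy]
  abel

theorem φ_cov_ξ (u : Euc n) : φ y (covField G ξ y u) = u - η y u • ξ y := by
  have hφξ : (fun z => φ z (ξ z)) =ᶠ[𝓝 y] fun _ => 0 :=
    eventually_of_mem (S.metric.mem_nhds hy) S.φ_ξ
  have hleibniz := fderiv_apply_field (S.differentiableAt_φ hy) (S.differentiableAt_ξ hy) u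
  rw [hφξ.fderiv_eq, fderiv_const_apply, zero_apply, S.fderiv_φ hy, S.φ_ξ y hy, map_zero,
    S.η_ξ y hy, S.inner_ξ hy, one_smul, sub_zero] at hleibniz
  rw [covField, map_add, ← sub_eq_zero, hleibniz]
  abel

theorem η_cov_ξ (u : Euc n) : η y (covField G ξ y u) = 0 := by
  have hnorm : (fun z => G z (ξ z) (ξ z)) =ᶠ[𝓝 y] fun _ => 1 :=
    eventually_of_mem (S.metric.mem_nhds hy) fun z hz =>
      (S.inner_ξ hz (ξ z)).trans (S.η_ξ z hz)
  have hleibniz := S.metric.fderiv_inner hy (S.differentiableAt_ξ hy) (S.differentiableAt_ξ hy) u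
  rw [hnorm.fderiv_eq, fderiv_const_apply, zero_apply, S.inner_ξ hy, ← S.η_eq y hy] at hleibniz
  linarith

theorem cov_ξ (u : Euc n) : covField G ξ y u = -φ y u := by
  have hφφ := S.φ_φ y hy (covField G ξ y u)
  rw [S.φ_cov_ξ hy, S.η_cov_ξ hy, zero_smul, add_zero, map_sub, map_smul, S.φ_ξ y hy, smul_zero,
    sub_zero] at hφφ
  rw [hφφ, neg_neg]

theorem cov_η (u v : Euc n) : covOneForm G η y u v = G y u (φ y v) := by
  rw [covOneForm_congr (S.η_eventuallyEq hy), S.metric.covOneForm_inner hy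
    (S.differentiableAt_ξ hy), S.cov_ξ hy, map_neg, neg_apply, S.φ_skew hy, neg_neg]

theorem fderiv_η (u v : Euc n) :
    fderiv ℝ η y u v = η y (christoffel G y u v) + G y u (φ y v) := by
  rw [← S.cov_η hy, covOneForm]
  ring

theorem ricci_eq (v w : Euc n) :
    ricci G y v w = ((c - 1) / 2 + (n - 1) * (c + 3) / 4) * G y v w
      - (c - 1) * (n + 1) / 4 * (η y v * η y w) := by
  have hsymm := (S.metric.inner y hy).symm
  have hcurv : ∀ u, curvature G y u v w = (-((c - 1) / 4) •
      ((η y w * η y v) • ContinuousLinearMap.id ℝ (Euc n) - η y w • (η y).smulRight v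
        + G y v w • (η y).smulRight (ξ y) - η y v • (G y w).smulRight (ξ y)
        + (G y w ∘L φ y).smulRight (φ y v) + (2 : ℝ) • (G y v ∘L φ y).smulRight (φ y w)
        - G y (φ y v) w • φ y)
      + ((c + 3) / 4) • (G y v w • ContinuousLinearMap.id ℝ (Euc n)
        - (G y w).smulRight v)) u := by
    intro u
    rw [S.curv y hy, hsymm (φ y u) w, hsymm (φ y u) v, hsymm u w]
    simp only [add_apply, sub_apply, smul_apply, ContinuousLinearMap.smulRight_apply,
      ContinuousLinearMap.comp_apply, ContinuousLinearMap.id_apply]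
    module
  rw [ricci_eq_trace hcurv]
  simp only [ContinuousLinearMap.toLinearMap_add, ContinuousLinearMap.toLinearMap_sub,
    ContinuousLinearMap.toLinearMap_smul, map_add, map_sub, map_smul, clm_trace_smulRight,
    ContinuousLinearMap.coe_id, LinearMap.trace_id, finrank_euclideanSpace_fin,
    trace_eq_zero_of_skew (S.metric.inner y hy) (φ y) (S.φ_skew hy),
    ContinuousLinearMap.comp_apply, S.φ_φ y hy, S.η_ξ y hy, S.inner_ξ hy, map_neg, smul_eq_mul,
    hsymm w v]
  ring

theorem ricciForm_eq : ricciForm G y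
    = ricciMetricCoeff n c • G y + ricciContactCoeff n c • (η y).smulRight (η y) := by
  refine ricciForm_eq_of_ricci_eq fun v w => ?_
  rw [S.ricci_eq hy, ricciMetricCoeff, ricciContactCoeff]
  simp only [add_apply, smul_apply, ContinuousLinearMap.smulRight_apply, smul_eq_mul]
  ring

theorem ricciForm_apply (u v : Euc n) : ricciForm G y u v
    = ricciMetricCoeff n c * G y u v + ricciContactCoeff n c * (η y u * η y v) := by
  rw [S.ricciForm_eq hy]
  simp only [add_apply, smul_apply, ContinuousLinearMap.smulRight_apply, smul_eq_mul]

theorem ricciForm_ξ_ξ : ricciForm G y (ξ y) (ξ y) = n - 1 := by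
  rw [S.ricciForm_apply hy, S.inner_ξ hy, S.η_ξ y hy, mul_one, mul_one, mul_one,
    ricciMetricCoeff_add_ricciContactCoeff]

theorem ξ_ne_zero : ξ y ≠ 0 := fun h => by
  have hη := S.η_ξ y hy
  rw [h, map_zero] at hη
  exact zero_ne_one hη

theorem contDiffAt_ricciForm : ContDiffAt ℝ ∞ (ricciForm G) y := by
  have hRic : ricciForm G =ᶠ[𝓝 y] fun z =>
      ricciMetricCoeff n c • G z + ricciContactCoeff n c • (η z).smulRight (η z) := by
    filter_upwards [S.metric.mem_nhds hy] with z hz using S.ricciForm_eq hz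
  exact (((S.metric.smooth y hy).const_smul _).add
    (((S.contDiffAt_η hy).smulRight (S.contDiffAt_η hy)).const_smul _)).congr_of_eventuallyEq hRic

omit hy in
theorem riemannianOn_ricciForm (hRic : ∀ y ∈ W, ∀ u, u ≠ 0 → 0 < ricciForm G y u u) :
    RiemannianOn W (ricciForm G) where
  isOpen := S.metric.isOpen
  smooth _ hy := S.contDiffAt_ricciForm hy
  inner y hy :=
    { symm := fun u v => by
        rw [S.ricciForm_apply hy, S.ricciForm_apply hy, (S.metric.inner y hy).symm,
          mul_comm (η y u)]
      pos := hRic y hy }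

end SasakianOn

end Sasakian

/-! ### Deformations along the contact form -/

section Deformation

variable {n : ℕ} {W : Set (Euc n)} {G K : FormField n} {φ : Euc n → Euc n →L[ℝ] Euc n}
  {ξ : Euc n → Euc n} {η : Euc n → Euc n →L[ℝ] ℝ} {c α β : ℝ}

/-- `K` is the Riemannian metric `αG + βη ⊗ η`. -/
structure DeformationOn (W : Set (Euc n)) (G K : FormField n) (η : Euc n → Euc n →L[ℝ] ℝ)
    (α β : ℝ) : Prop where
  metric : RiemannianOn W K
  eq : ∀ y ∈ W, K y = α • G y + β • (η y).smulRight (η y)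
  α_pos : 0 < α

namespace DeformationOn

variable (R : DeformationOn W G K η α β) (S : SasakianOn W G φ ξ η c) {y : Euc n} (hy : y ∈ W)
include R hy

theorem apply (u v : Euc n) : K y u v = α * G y u v + β * (η y u * η y v) := by
  rw [R.eq y hy]
  simp only [add_apply, smul_apply, ContinuousLinearMap.smulRight_apply, smul_eq_mul]

include S

theorem fderiv_eq (u v w : Euc n) : fderiv ℝ K y u v w
    = α * fderiv ℝ G y u v w + β * (fderiv ℝ η y u v * η y w + η y v * fderiv ℝ η y u w) := by
  have hG := (S.metric.differentiableAt hy)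
  have hη := S.differentiableAt_η hy
  have hηv : ∀ v, DifferentiableAt ℝ (fun z => η z v) y := fun v =>
    hη.clm_apply (differentiableAt_const v)
  have hGvw : DifferentiableAt ℝ (fun z => G z v w) y :=
    (hG.clm_apply (differentiableAt_const v)).clm_apply (differentiableAt_const w)
  have hKvw : (fun z => K z v w) =ᶠ[𝓝 y] fun z => α * G z v w + β * (η z v * η z w) :=
    eventually_of_mem (S.metric.mem_nhds hy) fun z hz => R.apply hz v w
  rw [← fderiv_apply_apply (R.metric.differentiableAt hy), hKvw.fderiv_eq,
    fderiv_fun_add (hGvw.const_mul α) (((hηv v).fun_mul (hηv w)).const_mul β),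
    fderiv_const_mul hGvw, fderiv_const_mul ((hηv v).fun_mul (hηv w)),
    fderiv_fun_mul (hηv v) (hηv w)]
  simp only [add_apply, smul_apply, smul_eq_mul, fderiv_apply_apply hG, fderiv_apply_const hη]
  ring

theorem christoffel_eq (u v : Euc n) : christoffel K y u v
    = christoffel G y u v + (-(β / α)) • (η y u • φ y v + η y v • φ y u) := by
  have hα := R.α_pos.ne'
  refine R.metric.christoffel_eq_of_compatible hy
    (L := fun u v => christoffel G y u v + (-(β / α)) • (η y u • φ y v + η y v • φ y u))
    (fun u v => ?_) (fun u v w => ?_) u v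
  · rw [S.metric.christoffel_symm hy, add_comm (η y u • φ y v)]
  · rw [R.fderiv_eq S hy, S.metric.fderiv_eq hy, S.fderiv_η hy, S.fderiv_η hy]
    simp only [R.apply hy, map_add, map_smul, add_apply, smul_apply, smul_eq_mul, S.η_φ hy]
    rw [S.φ_skew hy v w, S.φ_skew hy u w, (S.metric.inner y hy).symm v (φ y u), S.φ_skew hy u v]
    field_simp
    ring

theorem fderiv_christoffel_eq (u v w : Euc n) : fderiv ℝ (christoffel K) y u v w
    = fderiv ℝ (christoffel G) y u v w
      + (-(β / α)) • (η y v • fderiv ℝ φ y u w + fderiv ℝ η y u v • φ y w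
        + (η y w • fderiv ℝ φ y u v + fderiv ℝ η y u w • φ y v)) := by
  have hΓK := (R.metric.contDiffAt_christoffel hy).differentiableAt (by simp)
  have hΓG := (S.metric.contDiffAt_christoffel hy).differentiableAt (by simp)
  have hη : ∀ v, DifferentiableAt ℝ (fun z => η z v) y := fun v =>
    (S.differentiableAt_η hy).clm_apply (differentiableAt_const v)
  have hφ : ∀ v, DifferentiableAt ℝ (fun z => φ z v) y := fun v =>
    (S.differentiableAt_φ hy).clm_apply (differentiableAt_const v)
  have hK : (fun z => christoffel K z v w) =ᶠ[𝓝 y] fun z => christoffel G z v w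
      + (-(β / α)) • (η z v • φ z w + η z w • φ z v) :=
    eventually_of_mem (S.metric.mem_nhds hy) fun z hz => R.christoffel_eq S hz v w
  have hGvw : DifferentiableAt ℝ (fun z => christoffel G z v w) y :=
    (hΓG.clm_apply (differentiableAt_const v)).clm_apply (differentiableAt_const w)
  have hηφ : ∀ v w, DifferentiableAt ℝ (fun z => η z v • φ z w) y := fun v w =>
    (hη v).fun_smul (hφ w)
  rw [← fderiv_apply_apply hΓK, hK.fderiv_eq,
    fderiv_fun_add hGvw (((hηφ v w).fun_add (hηφ w v)).fun_const_smul _),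
    fderiv_fun_const_smul ((hηφ v w).fun_add (hηφ w v)), fderiv_fun_add (hηφ v w) (hηφ w v),
    fderiv_fun_smul (hη v) (hφ w), fderiv_fun_smul (hη w) (hφ v)]
  simp only [add_apply, smul_apply, ContinuousLinearMap.smulRight_apply, fderiv_apply_apply hΓG,
    fderiv_apply_const (S.differentiableAt_η hy), fderiv_apply_const (S.differentiableAt_φ hy)]

theorem curvature_eq (u v w : Euc n) : curvature K y u v w = curvature G y u v w
    + (-(β / α)) • ((2 * G y u (φ y v)) • φ y w + G y u (φ y w) • φ y v - G y v (φ y w) • φ y u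
      + (η y v * G y u w - η y u * G y v w) • ξ y - (2 * η y w * η y v) • u
      + (2 * η y w * η y u) • v)
    + (β / α) ^ 2 • ((η y w * η y u) • φ y (φ y v) - (η y w * η y v) • φ y (φ y u)) := by
  have hskew : G y v (φ y u) = -G y u (φ y v) := by
    rw [(S.metric.inner y hy).symm, S.φ_skew hy]
  rw [curvature, curvature, R.fderiv_christoffel_eq S hy, R.fderiv_christoffel_eq S hy]
  simp only [R.christoffel_eq S hy, S.fderiv_φ hy, S.fderiv_η hy, map_add, map_smul, S.η_φ hy,
    hskew, S.metric.christoffel_symm hy v u, (S.metric.inner y hy).symm v u, smul_eq_mul]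
  module

end DeformationOn

end Deformation

/-! ### Hypersurfaces tangent to the Reeb field -/

section Reeb

variable {k : ℕ}

/-- A hypersurface of a Sasakian space form with unit normal `N`, tangent to `ξ`. -/
structure ReebHypersurface (U : Set (Euc k)) (W : Set (Euc (k + 1))) (G : FormField (k + 1))
    (φ : Euc (k + 1) → Euc (k + 1) →L[ℝ] Euc (k + 1)) (ξ : Euc (k + 1) → Euc (k + 1))
    (η : Euc (k + 1) → Euc (k + 1) →L[ℝ] ℝ) (c : ℝ) (f N : Euc k → Euc (k + 1)) : Prop where
  sasakian : SasakianOn W G φ ξ η c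
  immersion : ImmersionOn U W f
  normal : NormalOn U G f N 1
  tangent : ∀ x ∈ U, ∃ u, fderiv ℝ f x u = ξ (f x)

/-- The form `Φ(u, v) = g(φu, v)` induced on a hypersurface. -/
noncomputable def inducedΦ (G : FormField (k + 1))
    (φ : Euc (k + 1) → Euc (k + 1) →L[ℝ] Euc (k + 1)) (f : Euc k → Euc (k + 1)) : FormField k :=
  fun x => (G (f x) ∘L φ (f x)).bilinearComp (fderiv ℝ f x) (fderiv ℝ f x)

/-- The form induced by `η` on a hypersurface. -/
noncomputable def inducedη (η : Euc (k + 1) → Euc (k + 1) →L[ℝ] ℝ) (f : Euc k → Euc (k + 1))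
    (x : Euc k) : Euc k →L[ℝ] ℝ := η (f x) ∘L fderiv ℝ f x

/-- The form `ν(u) = g(V, u) = g(N, φu)` of a hypersurface with unit normal `N`. -/
noncomputable def inducedν (G : FormField (k + 1))
    (φ : Euc (k + 1) → Euc (k + 1) →L[ℝ] Euc (k + 1)) (f N : Euc k → Euc (k + 1))
    (x : Euc k) : Euc k →L[ℝ] ℝ := G (f x) (N x) ∘L φ (f x) ∘L fderiv ℝ f x

variable {U : Set (Euc k)} {W : Set (Euc (k + 1))} {G : FormField (k + 1)}
  {φ : Euc (k + 1) → Euc (k + 1) →L[ℝ] Euc (k + 1)} {ξ : Euc (k + 1) → Euc (k + 1)}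
  {η : Euc (k + 1) → Euc (k + 1) →L[ℝ] ℝ} {c : ℝ} {f N : Euc k → Euc (k + 1)}

theorem inducedΦ_apply (x u v : Euc k) : inducedΦ G φ f x u v
    = G (f x) (φ (f x) (fderiv ℝ f x u)) (fderiv ℝ f x v) := rfl

theorem inducedη_apply (x u : Euc k) : inducedη η f x u = η (f x) (fderiv ℝ f x u) := rfl

theorem inducedν_apply (x u : Euc k) : inducedν G φ f N x u
    = G (f x) (N x) (φ (f x) (fderiv ℝ f x u)) := rfl

theorem ImmersionOn.covAlong_comp (hf : ImmersionOn U W f) {x : Euc k} (hx : x ∈ U)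
    (hξ : DifferentiableAt ℝ ξ (f x)) (u : Euc k) :
    covAlong G f (fun z => ξ (f z)) x u = covField G ξ (f x) (fderiv ℝ f x u) := by
  have hξf : HasFDerivAt (fun z => ξ (f z)) _ x := hξ.hasFDerivAt.comp x (hf.hasFDerivAt hx)
  rw [covAlong, hξf.fderiv, ContinuousLinearMap.comp_apply, covField]

namespace ReebHypersurface

variable (X : ReebHypersurface U W G φ ξ η c f N)

include X in
theorem induced_metric : RiemannianOn U (induced G f) :=
  X.immersion.riemannianOn_induced X.sasakian.metric

variable {x : Euc k} (hx : x ∈ U)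
include X hx

theorem mem : f x ∈ W := X.immersion.mapsTo x hx

theorem inner_symm (u v : Euc (k + 1)) : G (f x) u v = G (f x) v u :=
  (X.sasakian.metric.inner _ (X.mem hx)).symm u v

theorem scalarForm_symm (u v : Euc k) : scalarForm G f N x u v = scalarForm G f N x v u :=
  NormalOn.scalarForm_symm X.immersion X.sasakian.metric hx u v

theorem secondForm_eq (u v : Euc k) : secondForm G f x u v = scalarForm G f N x u v • N x := by
  rw [X.normal.secondForm_eq X.immersion X.sasakian.metric hx, div_one]

theorem η_N : η (f x) (N x) = 0 := by
  obtain ⟨u, hu⟩ := X.tangent x hx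
  rw [← X.sasakian.inner_ξ (X.mem hx), ← hu, X.normal.normal x hx]

theorem inner_N_ξ : G (f x) (N x) (ξ (f x)) = 0 := by
  rw [X.sasakian.inner_ξ (X.mem hx), X.η_N hx]

theorem fderiv_ζ : fderiv ℝ f x (sharp (induced G f) (inducedη η f) x) = ξ (f x) := by
  obtain ⟨u, hu⟩ := X.tangent x hx
  rw [X.induced_metric.sharp_eq hx (v := u) fun w => ?_, hu]
  rw [inducedη_apply, induced_apply, hu, X.sasakian.η_eq _ (X.mem hx)]

theorem fderiv_V :
    fderiv ℝ f x (sharp (induced G f) (inducedν G φ f N) x) = -φ (f x) (N x) := by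
  obtain ⟨u, hu⟩ := X.normal.exists_tangent X.immersion hx (y := -φ (f x) (N x))
    (by rw [map_neg, X.sasakian.inner_φ_self (X.mem hx), neg_zero])
  rw [X.induced_metric.sharp_eq hx (v := u) fun w => ?_, hu]
  rw [inducedν_apply, induced_apply, hu, map_neg, neg_apply, X.sasakian.φ_skew (X.mem hx), neg_neg]

theorem fderiv_shapeOperator (u : Euc k) :
    fderiv ℝ f x (shapeOperator (induced G f) (scalarForm G f N) x u) = -covAlong G f N x u := by
  have hself := X.normal.inner_covAlong_self X.immersion X.sasakian.metric hx u
  rw [X.inner_symm hx] at hself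
  obtain ⟨v, hv⟩ := X.normal.exists_tangent X.immersion hx (y := -covAlong G f N x u)
    (by rw [map_neg, hself, neg_zero])
  suffices shapeOperator (induced G f) (scalarForm G f N) x u = v by rw [this, hv]
  refine (X.induced_metric.inner x hx).ext fun w => ?_
  rw [X.induced_metric.inner_shapeOperator hx, induced_apply, hv, map_neg, neg_apply,
    X.normal.inner_covAlong_tangent X.immersion X.sasakian.metric hx, neg_neg]

theorem contDiffAt_inducedη : ContDiffAt ℝ ∞ (inducedη η f) x :=
  ((X.sasakian.contDiffAt_η (X.mem hx)).comp x (X.immersion.smooth x hx)).clm_comp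
    (X.immersion.contDiffAt_fderiv hx)

theorem contDiffAt_inducedν : ContDiffAt ℝ ∞ (inducedν G φ f N) x :=
  ((X.immersion.contDiffAt_metric hx X.sasakian.metric).clm_apply
    (X.normal.smooth x hx)).clm_comp
    (((X.sasakian.smooth_φ _ (X.mem hx)).comp x (X.immersion.smooth x hx)).clm_comp
      (X.immersion.contDiffAt_fderiv hx))

theorem inducedη_V : inducedη η f x (sharp (induced G f) (inducedν G φ f N) x) = 0 := by
  rw [inducedη_apply, X.fderiv_V hx, map_neg, X.sasakian.η_φ (X.mem hx), neg_zero]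

theorem inducedν_V : inducedν G φ f N x (sharp (induced G f) (inducedν G φ f N) x) = 1 := by
  rw [inducedν_apply, X.fderiv_V hx, map_neg, X.sasakian.φ_φ _ (X.mem hx), X.η_N hx, zero_smul,
    add_zero, neg_neg, X.normal.norm x hx]

theorem inducedη_ζ : inducedη η f x (sharp (induced G f) (inducedη η f) x) = 1 := by
  rw [inducedη_apply, X.fderiv_ζ hx, X.sasakian.η_ξ _ (X.mem hx)]

theorem inducedν_ζ : inducedν G φ f N x (sharp (induced G f) (inducedη η f) x) = 0 := by
  rw [inducedν_apply, X.fderiv_ζ hx, X.sasakian.φ_ξ _ (X.mem hx), map_zero]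

theorem inducedΦ_skew (u v : Euc k) : inducedΦ G φ f x u v = -inducedΦ G φ f x v u := by
  rw [inducedΦ_apply, inducedΦ_apply, X.sasakian.φ_skew (X.mem hx), X.inner_symm hx]

theorem inducedΦ_V (u : Euc k) :
    inducedΦ G φ f x u (sharp (induced G f) (inducedν G φ f N) x) = 0 := by
  rw [inducedΦ_apply, X.sasakian.φ_skew (X.mem hx), X.fderiv_V hx, map_neg,
    X.sasakian.φ_φ _ (X.mem hx), X.η_N hx, zero_smul, add_zero, neg_neg, X.inner_symm hx,
    X.normal.normal x hx, neg_zero]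

theorem inducedΦ_ζ (u : Euc k) :
    inducedΦ G φ f x u (sharp (induced G f) (inducedη η f) x) = 0 := by
  rw [inducedΦ_apply, X.fderiv_ζ hx, X.sasakian.inner_ξ (X.mem hx), X.sasakian.η_φ (X.mem hx)]

theorem inducedΦ_nondeg (w : Euc k) (hΦ : ∀ u, inducedΦ G φ f x u w = 0)
    (hη : inducedη η f x w = 0) (hν : inducedν G φ f N x w = 0) : w = 0 := by
  have hφw : φ (f x) (fderiv ℝ f x w) = 0 := by
    rw [X.normal.eq_smul_of_normal X.immersion X.sasakian.metric hx
      (y := φ (f x) (fderiv ℝ f x w)) fun u => ?_, ← inducedν_apply, hν, zero_div, zero_smul]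
    rw [← inducedΦ_apply, X.inducedΦ_skew hx, hΦ, neg_zero]
  have hφφw := X.sasakian.φ_φ _ (X.mem hx) (fderiv ℝ f x w)
  rw [hφw, map_zero, ← inducedη_apply, hη, zero_smul, add_zero, eq_comm, neg_eq_zero] at hφφw
  exact X.immersion.injective x hx (by rw [hφφw, map_zero])

theorem differentiableAt_ξ : DifferentiableAt ℝ (fun z => ξ (f z)) x :=
  (X.sasakian.differentiableAt_ξ (X.mem hx)).comp x (X.immersion.hasFDerivAt hx).differentiableAt

theorem covAlong_ξ (u : Euc k) :
    covAlong G f (fun z => ξ (f z)) x u = -φ (f x) (fderiv ℝ f x u) := by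
  rw [X.immersion.covAlong_comp hx (X.sasakian.differentiableAt_ξ (X.mem hx)),
    X.sasakian.cov_ξ (X.mem hx)]

theorem covAlong_φ_fderiv (u w : Euc k) : covAlong G f (fun z => φ (f z) (fderiv ℝ f z w)) x u
    = G (f x) (fderiv ℝ f x u) (fderiv ℝ f x w) • ξ (f x) - inducedη η f x w • fderiv ℝ f x u
      + φ (f x) (covAlong G f (fun z => fderiv ℝ f z w) x u) := by
  have hφf : HasFDerivAt (fun z => φ (f z)) _ x :=
    (X.sasakian.differentiableAt_φ (X.mem hx)).hasFDerivAt.comp x (X.immersion.hasFDerivAt hx)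
  have hfw := (X.immersion.contDiffAt_fderiv_apply hx w).differentiableAt (by simp)
  rw [covAlong, fderiv_apply_field hφf.differentiableAt hfw, hφf.fderiv,
    ContinuousLinearMap.comp_apply, X.sasakian.fderiv_φ (X.mem hx), covAlong, map_add,
    inducedη_apply]
  abel

theorem cov_inducedη (u w : Euc k) :
    covOneForm (induced G f) (inducedη η f) x u w = -inducedΦ G φ f x u w := by
  have hη : (fun z => inducedη η f z w) =ᶠ[𝓝 x] fun z => G (f z) (ξ (f z)) (fderiv ℝ f z w) :=
    eventually_of_mem (X.immersion.mem_nhds hx) fun z hz => X.sasakian.η_eq _ (X.mem hz) _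
  rw [covOneForm, ← fderiv_apply_const ((X.contDiffAt_inducedη hx).differentiableAt (by simp)),
    hη.fderiv_eq, X.immersion.fderiv_inner hx X.sasakian.metric (X.differentiableAt_ξ hx)
      ((X.immersion.contDiffAt_fderiv_apply hx w).differentiableAt (by simp)),
    X.covAlong_ξ hx, X.immersion.covAlong_fderiv hx, X.secondForm_eq hx, map_neg, neg_apply,
    ← X.sasakian.η_eq _ (X.mem hx), map_add, map_smul, X.η_N hx, smul_zero, add_zero,
    inducedη_apply, inducedΦ_apply, add_sub_cancel_right]

theorem cov_inducedν (u w : Euc k) : covOneForm (induced G f) (inducedν G φ f N) x u w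
    = inducedΦ G φ f x (shapeOperator (induced G f) (scalarForm G f N) x u) w := by
  have hφw : DifferentiableAt ℝ (fun z => φ (f z) (fderiv ℝ f z w)) x :=
    ((X.sasakian.differentiableAt_φ (X.mem hx)).comp x
      (X.immersion.hasFDerivAt hx).differentiableAt).clm_apply
      ((X.immersion.contDiffAt_fderiv_apply hx w).differentiableAt (by simp))
  rw [covOneForm, ← fderiv_apply_const ((X.contDiffAt_inducedν hx).differentiableAt (by simp))]
  simp only [inducedν_apply]
  rw [X.immersion.fderiv_inner hx X.sasakian.metric (X.normal.differentiableAt hx) hφw,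
    inducedΦ_apply, X.fderiv_shapeOperator hx, map_neg, map_neg, neg_apply,
    X.sasakian.φ_skew (X.mem hx), X.covAlong_φ_fderiv hx, X.immersion.covAlong_fderiv hx,
    X.secondForm_eq hx]
  simp only [map_add, map_sub, map_smul, X.inner_N_ξ hx, X.normal.normal x hx,
    X.sasakian.inner_φ_self (X.mem hx), smul_zero]
  ring

theorem scalarForm_ζ (w : Euc k) :
    scalarForm G f N x (sharp (induced G f) (inducedη η f) x) w = -inducedν G φ f N x w := by
  have hNξ : (fun z => G (f z) (N z) (ξ (f z))) =ᶠ[𝓝 x] fun _ => 0 :=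
    eventually_of_mem (X.immersion.mem_nhds hx) fun z hz => X.inner_N_ξ hz
  have hleibniz := X.immersion.fderiv_inner hx X.sasakian.metric (X.normal.differentiableAt hx)
    (X.differentiableAt_ξ hx) w
  have htangent := X.normal.inner_covAlong_tangent X.immersion X.sasakian.metric hx w
    (sharp (induced G f) (inducedη η f) x)
  rw [X.fderiv_ζ hx, X.scalarForm_symm hx] at htangent
  rw [hNξ.fderiv_eq, fderiv_const_apply, zero_apply, X.covAlong_ξ hx, htangent, map_neg,
    ← inducedν_apply] at hleibniz
  linarith

theorem codazzi (u v w : Euc k) :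
    covForm (induced G f) (scalarForm G f N) x u v w
        - covForm (induced G f) (scalarForm G f N) x v u w
      = -((c - 1) / 4) * (inducedΦ G φ f x u w * inducedν G φ f N x v
        + 2 * inducedΦ G φ f x u v * inducedν G φ f N x w
        - inducedΦ G φ f x v w * inducedν G φ f N x u) := by
  rw [X.normal.codazzi X.immersion X.sasakian.metric hx, X.sasakian.curv _ (X.mem hx)]
  simp only [map_add, map_sub, map_smul, X.inner_N_ξ hx, X.normal.normal x hx, smul_eq_mul,
    inducedν_apply, inducedΦ_apply]
  ring

end ReebHypersurface

end Reeb

/-! ### The tangential Ricci-biharmonic equation -/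

section TangentialEquation

variable {k : ℕ}

theorem curvature_smul {n : ℕ} (G : FormField n) (y u v w : Euc n) (t : ℝ) :
    curvature G y u (t • v) w = t • curvature G y u v w := by
  simp only [curvature, map_smul, smul_apply]
  module

variable {U : Set (Euc k)} {W : Set (Euc (k + 1))} {G K : FormField (k + 1)}
  {φ : Euc (k + 1) → Euc (k + 1) →L[ℝ] Euc (k + 1)} {ξ : Euc (k + 1) → Euc (k + 1)}
  {η : Euc (k + 1) → Euc (k + 1) →L[ℝ] ℝ} {c α β : ℝ} {f N : Euc k → Euc (k + 1)}

namespace ReebHypersurface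

variable (X : ReebHypersurface U W G φ ξ η c f N) (R : DeformationOn W G K η α β)
include X R

theorem normal_deformation : NormalOn U K f N α where
  smooth := X.normal.smooth
  normal x hx u := by
    rw [R.apply (X.mem hx), X.normal.normal x hx, X.η_N hx, mul_zero, zero_mul, mul_zero, add_zero]
  norm x hx := by
    rw [R.apply (X.mem hx), X.normal.norm x hx, X.η_N hx, mul_one, zero_mul, mul_zero, add_zero]
  pos := R.α_pos

theorem induced_metric_deformation : RiemannianOn U (induced K f) :=
  X.immersion.riemannianOn_induced R.metric

variable {x : Euc k} (hx : x ∈ U)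
include hx

theorem deformation_N (v : Euc (k + 1)) : K (f x) (N x) v = α * G (f x) (N x) v := by
  rw [R.apply (X.mem hx), X.η_N hx, zero_mul, mul_zero, add_zero]

theorem scalarForm_deformation (u v : Euc k) : scalarForm K f N x u v
    = α * scalarForm G f N x u v
      - β * (inducedη η f x u * inducedν G φ f N x v
        + inducedν G φ f N x u * inducedη η f x v) := by
  have hα := R.α_pos.ne'
  rw [← (X.normal_deformation R).inner_covAlong_fderiv X.immersion hx,
    ← X.normal.inner_covAlong_fderiv X.immersion hx, X.deformation_N R hx, covAlong, covAlong,
    R.christoffel_eq X.sasakian (X.mem hx)]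
  simp only [map_add, map_smul, smul_eq_mul, inducedη_apply, inducedν_apply]
  field_simp
  ring

theorem induced_deformation (u v : Euc k) : induced K f x u v
    = α * induced G f x u v + β * (inducedη η f x u * inducedη η f x v) := by
  rw [induced_apply, R.apply (X.mem hx), induced_apply, inducedη_apply, inducedη_apply]

theorem inner_N_curvature (u v w : Euc k) :
    G (f x) (N x) (curvature K (f x) (fderiv ℝ f x u) (fderiv ℝ f x v) (fderiv ℝ f x w))
      = -((c - 1) / 4 - β / α) * (2 * inducedΦ G φ f x u v * inducedν G φ f N x w
        + inducedΦ G φ f x u w * inducedν G φ f N x v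
        - inducedΦ G φ f x v w * inducedν G φ f N x u) := by
  rw [R.curvature_eq X.sasakian (X.mem hx), X.sasakian.curv _ (X.mem hx)]
  simp only [map_add, map_sub, map_smul, map_neg, X.inner_N_ξ hx, X.normal.normal x hx,
    smul_eq_mul, inducedν_apply, inducedΦ_apply, X.sasakian.φ_skew (X.mem hx),
    X.sasakian.φ_φ _ (X.mem hx)]
  ring

theorem inner_curvature_N (u v w : Euc k) :
    K (f x) (fderiv ℝ f x w) (curvature K (f x) (fderiv ℝ f x u) (N x) (fderiv ℝ f x v))
      = α * ((c - 1) / 4 - β / α) * (2 * inducedν G φ f N x u * inducedΦ G φ f x w v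
        + inducedν G φ f N x w * inducedΦ G φ f x u v
        + inducedν G φ f N x v * inducedΦ G φ f x w u) := by
  have htangent : ∀ u, G (f x) (fderiv ℝ f x u) (N x) = 0 := fun u => by
    rw [X.inner_symm hx, X.normal.normal x hx]
  have hφN : ∀ u, G (f x) (fderiv ℝ f x u) (φ (f x) (N x)) = -inducedν G φ f N x u := fun u => by
    rw [X.inner_symm hx, X.sasakian.φ_skew (X.mem hx), inducedν_apply]
  rw [R.apply (X.mem hx), R.curvature_eq X.sasakian (X.mem hx), X.sasakian.curv _ (X.mem hx)]
  simp only [map_add, map_sub, map_smul, map_neg, X.η_N hx, X.normal.normal x hx, htangent,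
    smul_eq_mul, inducedΦ_apply, X.sasakian.φ_skew (X.mem hx), X.sasakian.φ_φ _ (X.mem hx),
    X.sasakian.η_φ (X.mem hx), hφN]
  simp only [← inducedν_apply]
  ring

variable (hαβ : α + β ≠ 0)
include hαβ

theorem inverse_deformation (a : Euc k →L[ℝ] ℝ) :
    (induced K f x).inverse a = (1 / α) • (induced G f x).inverse a
      - (β / (α * (α + β)) * a (sharp (induced G f) (inducedη η f) x)) •
        sharp (induced G f) (inducedη η f) x := by
  have hα := R.α_pos.ne'
  have hK := (X.induced_metric_deformation R).inner x hx
  have hg := X.induced_metric.inner x hx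
  refine hK.ext fun w => ?_
  rw [hK.apply_inverse, X.induced_deformation R hx]
  have hcomm : inducedη η f x ((induced G f x).inverse a)
      = a (sharp (induced G f) (inducedη η f) x) := hg.apply_inverse_comm _ _
  simp only [map_sub, map_smul, sub_apply, smul_apply, smul_eq_mul, hg.apply_inverse,
    X.induced_metric.inner_sharp hx, X.inducedη_ζ hx, hcomm]
  field_simp
  ring

theorem formTrace_deformation (T : Euc k →L[ℝ] Euc k →L[ℝ] ℝ) :
    formTrace (induced K f x) (fun u v => T u v)
      = 1 / α * formTrace (induced G f x) (fun u v => T u v)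
        - β / (α * (α + β)) * T (sharp (induced G f) (inducedη η f) x)
          (sharp (induced G f) (inducedη η f) x) := by
  simp only [formTrace, X.inverse_deformation R hx hαβ, map_sub, map_smul, smul_eq_mul]
  rw [Finset.sum_sub_distrib, ← Finset.mul_sum,
    clm_eq_sum T (sharp (induced G f) (inducedη η f) x)]
  simp only [sum_apply, smul_apply, smul_eq_mul, Finset.mul_sum, PiLp.proj_apply, mul_assoc]

theorem inverse_deformation_inducedν :
    (induced K f x).inverse (inducedν G φ f N x)
      = (1 / α) • sharp (induced G f) (inducedν G φ f N) x := by
  rw [X.inverse_deformation R hx hαβ, X.inducedν_ζ hx, mul_zero, zero_smul, sub_zero, sharp]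

theorem formTrace_scalarForm_deformation :
    formTrace (induced K f x) (fun u v => scalarForm K f N x u v)
      = formTrace (induced G f x) fun u v => scalarForm G f N x u v := by
  have hα := R.α_pos.ne'
  have htrace : formTrace (induced G f x) (fun u v => scalarForm K f N x u v)
      = α * formTrace (induced G f x) (fun u v => scalarForm G f N x u v) := by
    simp only [X.scalarForm_deformation R hx]
    rw [formTrace_sub, formTrace_mul, formTrace_mul, formTrace_add, formTrace_mul_apply,
      formTrace_mul_apply, ← sharp, ← sharp, X.inducedν_ζ hx, X.inducedη_V hx]
    ring
  rw [X.formTrace_deformation R hx hαβ, htrace, X.scalarForm_deformation R hx, X.scalarForm_ζ hx,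
    X.inducedν_ζ hx]
  field_simp
  ring

theorem scalarForm_sharp_deformation (a : Euc k → Euc k →L[ℝ] ℝ) (w : Euc k) :
    scalarForm K f N x (sharp (induced K f) a x) w
      = scalarForm G f N x (sharp (induced G f) a x) w
        - β / α * a x (sharp (induced G f) (inducedν G φ f N) x) * inducedη η f x w := by
  have hα := R.α_pos.ne'
  have hg := X.induced_metric
  rw [sharp, X.inverse_deformation R hx hαβ, ← sharp]
  simp only [map_sub, map_smul, sub_apply, smul_apply, smul_eq_mul, X.scalarForm_deformation R hx,
    X.scalarForm_ζ hx, X.inducedν_ζ hx, X.inducedη_ζ hx, hg.apply_sharp_comm hx (inducedη η f) a,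
    hg.apply_sharp_comm hx (inducedν G φ f N) a]
  field_simp
  ring

theorem formTrace_inducedν_mul (w : Euc k) : formTrace (induced K f x)
    (fun u v => inducedν G φ f N x u * inducedΦ G φ f x w v) = 0 := by
  rw [formTrace_mul_apply, X.inverse_deformation_inducedν R hx hαβ, map_smul, X.inducedΦ_V hx,
    smul_zero]

theorem formTrace_mul_inducedν (w : Euc k) : formTrace (induced K f x)
    (fun u v => inducedΦ G φ f x w u * inducedν G φ f N x v) = 0 := by
  rw [formTrace_mul_apply, ((X.induced_metric_deformation R).inner x hx).apply_inverse_comm,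
    ← formTrace_mul_apply, X.formTrace_inducedν_mul R hx hαβ]

theorem formTrace_inner_N_curvature (w : Euc k) :
    formTrace (induced K f x) (fun u v => K (f x) (N x)
      (curvature K (f x) (fderiv ℝ f x u) (fderiv ℝ f x w) (fderiv ℝ f x v))) = 0 := by
  have hΦ := formTrace_eq_zero_of_antisymm ((X.induced_metric_deformation R).inner x hx)
    (inducedΦ G φ f x) (X.inducedΦ_skew hx)
  have hterm : ∀ u v, K (f x) (N x)
      (curvature K (f x) (fderiv ℝ f x u) (fderiv ℝ f x w) (fderiv ℝ f x v))
      = α * ((c - 1) / 4 - β / α) *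
        (2 * (inducedΦ G φ f x w u * inducedν G φ f N x v)
          - inducedν G φ f N x w * inducedΦ G φ f x u v
          + inducedν G φ f N x u * inducedΦ G φ f x w v) := by
    intro u v
    rw [X.deformation_N R hx, X.inner_N_curvature R hx, X.inducedΦ_skew hx u w]
    ring
  simp only [hterm]
  rw [formTrace_mul, formTrace_add, formTrace_sub, formTrace_mul, formTrace_mul,
    X.formTrace_mul_inducedν R hx hαβ, hΦ, X.formTrace_inducedν_mul R hx hαβ]
  ring

theorem formTrace_inner_curvature_N (w : Euc k) :
    formTrace (induced K f x) (fun u v => K (f x) (fderiv ℝ f x w)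
      (curvature K (f x) (fderiv ℝ f x u) (N x) (fderiv ℝ f x v))) = 0 := by
  have hΦ := formTrace_eq_zero_of_antisymm ((X.induced_metric_deformation R).inner x hx)
    (inducedΦ G φ f x) (X.inducedΦ_skew hx)
  have hterm : ∀ u v, K (f x) (fderiv ℝ f x w)
      (curvature K (f x) (fderiv ℝ f x u) (N x) (fderiv ℝ f x v))
      = α * ((c - 1) / 4 - β / α) *
        (2 * (inducedν G φ f N x u * inducedΦ G φ f x w v)
          + inducedν G φ f N x w * inducedΦ G φ f x u v
          + inducedΦ G φ f x w u * inducedν G φ f N x v) := by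
    intro u v
    rw [X.inner_curvature_N R hx]
    ring
  simp only [hterm]
  rw [formTrace_mul, formTrace_add, formTrace_add, formTrace_mul, formTrace_mul,
    X.formTrace_mul_inducedν R hx hαβ, hΦ, X.formTrace_inducedν_mul R hx hαβ]
  ring

theorem tangential_equation {h : Euc k → ℝ} {r : ℝ} (hh : ∀ x ∈ U, ContDiffAt ℝ ∞ h x)
    (htr : ∀ x ∈ U, formTrace (induced G f x) (fun u v => scalarForm G f N x u v) = 2 * r * h x)
    (hbi : metricTrace (induced K f x) (covAlong₂ K f (fun z => h z • N z) x)
      - metricTrace (induced K f x) (fun u v =>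
        curvature K (f x) (fderiv ℝ f x u) (h x • N x) (fderiv ℝ f x v)) = 0) (w : Euc k) :
    scalarForm G f N x (sharp (induced G f) (fderiv ℝ h) x) w
      - β / α * fderiv ℝ h x (sharp (induced G f) (inducedν G φ f N) x) * inducedη η f x w
      = -(r * h x * fderiv ℝ h x w) := by
  have htrace : (fun z => formTrace (induced K f z) fun u v => scalarForm K f N z u v)
      =ᶠ[𝓝 x] fun z => 2 * r * h z :=
    eventually_of_mem (X.immersion.mem_nhds hx) fun z hz =>
      (X.formTrace_scalarForm_deformation R hz hαβ).trans (htr z hz)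
  have htangent := congrArg (K (f x) (fderiv ℝ f x w)) hbi
  simp only [curvature_smul] at htangent
  rw [map_sub, map_zero, (R.metric.inner _ (X.mem hx)).symm,
    (X.normal_deformation R).inner_metricTrace_covAlong₂ X.immersion R.metric hx hh,
    htrace.fderiv_eq, fderiv_const_mul ((hh x hx).differentiableAt (by simp)),
    X.formTrace_inner_N_curvature R hx hαβ, map_metricTrace] at htangent
  simp only [map_smul, smul_apply, smul_eq_mul] at htangent
  rw [formTrace_mul, X.formTrace_inner_curvature_N R hx hαβ,
    X.scalarForm_sharp_deformation R hx hαβ] at htangent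
  linear_combination (-1 / 2 : ℝ) * htangent

end ReebHypersurface

end TangentialEquation

/-! ### Pseudo-Hopf Ricci-biharmonic immersions in coordinates -/

section Local

section Congruence

variable {k n : ℕ} {G : FormField n} {f σ τ : Euc k → Euc n} {x : Euc k}

theorem covAlong_congr (h : σ =ᶠ[𝓝 x] τ) : covAlong G f σ x = covAlong G f τ x := by
  ext1 u
  rw [covAlong, covAlong, h.fderiv_eq, h.self_of_nhds]

theorem covAlong₂_congr (h : σ =ᶠ[𝓝 x] τ) : covAlong₂ G f σ x = covAlong₂ G f τ x := by
  ext1 u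
  ext1 v
  have hcov : (fun z => covAlong G f σ z v) =ᶠ[𝓝 x] fun z => covAlong G f τ z v := by
    filter_upwards [h.eventuallyEq_nhds] with z hz
    rw [covAlong_congr hz]
  rw [covAlong₂, covAlong₂, covAlong_congr hcov, covAlong_congr h]

end Congruence

variable {k : ℕ} {U : Set (Euc k)} {W : Set (Euc (k + 1))} {G : FormField (k + 1)}
  {f N : Euc k → Euc (k + 1)} {x : Euc k}

/-- The unit normal field `H / |H|`, with the junk value `0` where `H` vanishes. -/
noncomputable def unitMeanCurv (G : FormField (k + 1)) (f : Euc k → Euc (k + 1)) (x : Euc k) :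
    Euc (k + 1) :=
  (meanCurvNorm G f x)⁻¹ • meanCurv G f x

theorem meanCurvNorm_smul_unitMeanCurv (hpos : 0 < meanCurvNorm G f x) :
    meanCurvNorm G f x • unitMeanCurv G f x = meanCurv G f x :=
  smul_inv_smul₀ hpos.ne' _

theorem weingarten_eq_shapeOperator :
    weingarten G f x (N x) = shapeOperator (induced G f) (scalarForm G f N) x := rfl

theorem inner_meanCurv_eq_formTrace :
    G (f x) (N x) (meanCurv G f x)
      = 1 / k * formTrace (induced G f x) fun u v => scalarForm G f N x u v := by
  rw [meanCurv, map_smul, map_metricTrace, smul_eq_mul]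
  simp only [scalarForm_apply]

theorem meanCurvNorm_eventuallyEq_of_inner {x : Euc k}
    (h : ∀ᶠ z in 𝓝 x, G (f z) (meanCurv G f z) (meanCurv G f z)
      = G (f x) (meanCurv G f x) (meanCurv G f x)) :
    meanCurvNorm G f =ᶠ[𝓝 x] fun _ => meanCurvNorm G f x := by
  filter_upwards [h] with z hz
  rw [meanCurvNorm, meanCurvNorm, hz]

theorem gradMeanCurvNorm_eq_zero (h : meanCurvNorm G f =ᶠ[𝓝 x] fun _ => meanCurvNorm G f x) :
    gradMeanCurvNorm G f x = 0 := by
  rw [gradMeanCurvNorm, h.fderiv_eq, fderiv_const_apply, map_zero]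

namespace ImmersionOn

variable (hf : ImmersionOn U W f) (hG : RiemannianOn W G)
include hf hG

section Pointwise

variable (hx : x ∈ U)
include hx

theorem exists_isUnitNormal : ∃ ν, IsUnitNormal G f x ν := by
  have hg := (hf.riemannianOn_induced hG).inner x hx
  let tangentForm : Euc (k + 1) →L[ℝ] Euc k →L[ℝ] ℝ := (fderiv ℝ f x).precomp ℝ ∘L G (f x)
  let tangentPart : Euc (k + 1) →ₗ[ℝ] Euc k := (induced G f x).inverse ∘L tangentForm
  have hker : LinearMap.ker tangentPart ≠ ⊥ := LinearMap.ker_ne_bot_of_finrank_lt (by simp)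
  obtain ⟨ν, hν, hν0⟩ := Submodule.exists_mem_ne_zero_of_ne_bot hker
  have htangentForm : tangentForm ν = 0 := by
    have hν' : (induced G f x).inverse (tangentForm ν) = 0 := hν
    rw [← hg.apply_inverse (tangentForm ν), hν', map_zero]
  have hnormal : ∀ u, G (f x) ν (fderiv ℝ f x u) = 0 := fun u =>
    congrArg (fun a : Euc k →L[ℝ] ℝ => a u) htangentForm
  have hpos := (hG.inner _ (hf.mapsTo x hx)).pos ν hν0
  refine ⟨(√(G (f x) ν ν))⁻¹ • ν, fun u => ?_, ?_⟩
  · rw [map_smul, smul_apply, hnormal, smul_zero]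
  · rw [map_smul, map_smul, smul_apply, smul_eq_mul, smul_eq_mul, ← mul_assoc, ← mul_inv,
      Real.mul_self_sqrt hpos.le, inv_mul_cancel₀ hpos.ne']

theorem inner_meanCurv_fderiv (u : Euc k) : G (f x) (meanCurv G f x) (fderiv ℝ f x u) = 0 := by
  have hsymm := (hG.inner _ (hf.mapsTo x hx)).symm (fderiv ℝ f x u)
  rw [← hsymm, meanCurv, map_smul, map_metricTrace]
  simp [hsymm, hf.inner_secondForm hx hG, formTrace]

theorem contDiffAt_meanCurv : ContDiffAt ℝ ∞ (meanCurv G f) x :=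
  (ContDiffAt.sum fun _ _ =>
    ((hf.contDiffAt_secondForm hx hG).clm_apply contDiffAt_const).clm_apply
      (((hf.riemannianOn_induced hG).contDiffAt_inverse hx).clm_apply
        contDiffAt_const)).const_smul (1 / (k : ℝ))

theorem contDiffAt_inner_meanCurv :
    ContDiffAt ℝ ∞ (fun z => G (f z) (meanCurv G f z) (meanCurv G f z)) x :=
  ((hf.contDiffAt_metric hx hG).clm_apply (hf.contDiffAt_meanCurv hG hx)).clm_apply
    (hf.contDiffAt_meanCurv hG hx)

theorem inner_meanCurv_nonneg : 0 ≤ G (f x) (meanCurv G f x) (meanCurv G f x) :=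
  (hG.inner _ (hf.mapsTo x hx)).nonneg _

theorem meanCurvNorm_mul_self :
    meanCurvNorm G f x * meanCurvNorm G f x = G (f x) (meanCurv G f x) (meanCurv G f x) :=
  Real.mul_self_sqrt (hf.inner_meanCurv_nonneg hG hx)

theorem contDiffAt_meanCurvNorm (hpos : 0 < meanCurvNorm G f x) :
    ContDiffAt ℝ ∞ (meanCurvNorm G f) x :=
  (hf.contDiffAt_inner_meanCurv hG hx).sqrt (Real.sqrt_pos.1 hpos).ne'

theorem meanCurvNorm_pos
    (hne : fderiv ℝ (fun z => G (f z) (meanCurv G f z) (meanCurv G f z)) x ≠ 0) :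
    0 < meanCurvNorm G f x := by
  refine Real.sqrt_pos.2 ((hf.inner_meanCurv_nonneg hG hx).lt_of_ne fun hzero => hne ?_)
  have hmin : IsLocalMin (fun z => G (f z) (meanCurv G f z) (meanCurv G f z)) x := by
    filter_upwards [hf.mem_nhds hx] with z hz
    rw [← hzero]
    exact hf.inner_meanCurv_nonneg hG hz
  exact hmin.fderiv_eq_zero

theorem fderiv_meanCurvNorm_ne_zero
    (hne : fderiv ℝ (fun z => G (f z) (meanCurv G f z) (meanCurv G f z)) x ≠ 0) :
    fderiv ℝ (meanCurvNorm G f) x ≠ 0 := fun hzero => hne <| by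
  have hdiff := (hf.contDiffAt_meanCurvNorm hG hx (hf.meanCurvNorm_pos hG hx hne)).differentiableAt
    (by simp)
  have hsq : (fun z => G (f z) (meanCurv G f z) (meanCurv G f z))
      =ᶠ[𝓝 x] fun z => meanCurvNorm G f z * meanCurvNorm G f z :=
    eventually_of_mem (hf.mem_nhds hx) fun z hz => (hf.meanCurvNorm_mul_self hG hz).symm
  rw [hsq.fderiv_eq, fderiv_fun_mul hdiff hdiff, hzero, smul_zero, add_zero]

end Pointwise

variable (hpos : ∀ x ∈ U, 0 < meanCurvNorm G f x)
include hpos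

theorem normalOn_unitMeanCurv : NormalOn U G f (unitMeanCurv G f) 1 where
  smooth x hx := ((hf.contDiffAt_meanCurvNorm hG hx (hpos x hx)).inv (hpos x hx).ne').smul
    (hf.contDiffAt_meanCurv hG hx)
  normal x hx u := by
    rw [unitMeanCurv, map_smul, smul_apply, hf.inner_meanCurv_fderiv hG hx, smul_zero]
  norm x hx := by
    rw [unitMeanCurv, map_smul, map_smul, smul_apply, ← hf.meanCurvNorm_mul_self hG hx, smul_eq_mul,
      smul_eq_mul, inv_mul_cancel_left₀ (hpos x hx).ne', inv_mul_cancel₀ (hpos x hx).ne']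
  pos := one_pos

theorem formTrace_scalarForm_unitMeanCurv (hk : (k : ℝ) ≠ 0) (hx : x ∈ U) :
    formTrace (induced G f x) (fun u v => scalarForm G f (unitMeanCurv G f) x u v)
      = k * meanCurvNorm G f x := by
  have hinner := inner_meanCurv_eq_formTrace (G := G) (f := f) (N := unitMeanCurv G f) (x := x)
  rw [← meanCurvNorm_smul_unitMeanCurv (hpos x hx), map_smul,
    (hf.normalOn_unitMeanCurv hG hpos).norm x hx, smul_eq_mul, mul_one] at hinner
  rw [hinner]
  field_simp

end ImmersionOn

variable {φ : Euc (k + 1) → Euc (k + 1) →L[ℝ] Euc (k + 1)} {ξ : Euc (k + 1) → Euc (k + 1)}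
  {η : Euc (k + 1) → Euc (k + 1) →L[ℝ] ℝ} {c : ℝ}

namespace ReebHypersurface

variable (X : ReebHypersurface U W G φ ξ η c f N) (hx : x ∈ U)
include X hx

theorem N_ne_zero : N x ≠ 0 := fun h => by
  have hnorm := X.normal.norm x hx
  rw [h, map_zero] at hnorm
  exact zero_ne_one hnorm

theorem ricciForm_N_N : ricciForm G (f x) (N x) (N x) = ricciMetricCoeff (k + 1) c := by
  rw [X.sasakian.ricciForm_apply (X.mem hx), X.normal.norm x hx, X.η_N hx, mul_one, mul_zero,
    mul_zero, add_zero]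

theorem scalarForm_V (hV : fderiv ℝ f x (weingarten G f x (N x)
      (sharp (induced G f) (inducedν G φ f N) x)) ∈ Submodule.span ℝ {ξ (f x), -φ (f x) (N x)})
    (w : Euc k) :
    scalarForm G f N x (sharp (induced G f) (inducedν G φ f N) x) w
      = -inducedη η f x w
        + coeffV (induced G f) (scalarForm G f N) (inducedν G φ f N) x
          * inducedν G φ f N x w := by
  set ζ := sharp (induced G f) (inducedη η f) x
  set V := sharp (induced G f) (inducedν G φ f N) x with hVdef
  obtain ⟨s, t, hst⟩ := Submodule.mem_span_pair.1 hV
  have hAV : shapeOperator (induced G f) (scalarForm G f N) x V = s • ζ + t • V := by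
    refine X.immersion.injective x hx ?_
    rw [map_add, map_smul, map_smul, X.fderiv_ζ hx, X.fderiv_V hx, hst,
      weingarten_eq_shapeOperator]
  have hbV : ∀ w, scalarForm G f N x V w
      = s * inducedη η f x w + t * inducedν G φ f N x w := fun w => by
    rw [← X.induced_metric.inner_shapeOperator hx, hAV, map_add, map_smul, map_smul, add_apply,
      smul_apply, smul_apply, X.induced_metric.inner_sharp hx, X.induced_metric.inner_sharp hx,
      smul_eq_mul, smul_eq_mul]
  have hs : s = -1 := by
    have hζV := hbV ζ
    rw [X.scalarForm_symm hx, X.scalarForm_ζ hx, X.inducedν_V hx, X.inducedη_ζ hx,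
      X.inducedν_ζ hx] at hζV
    linarith
  have ht : t = coeffV (induced G f) (scalarForm G f N) (inducedν G φ f N) x := by
    rw [coeffV, ← hVdef, hbV, X.inducedη_V hx, X.inducedν_V hx]
    ring
  rw [hbV, hs, ht]
  ring

end ReebHypersurface

/-- The coordinate expression of a pseudo-Hopf Ricci-biharmonic hypersurface `f : U → W` of a
Sasakian space form with positive definite Ricci tensor. -/
structure RicciBiharmonicHopf (U : Set (Euc k)) (W : Set (Euc (k + 1))) (G : FormField (k + 1))
    (φ : Euc (k + 1) → Euc (k + 1) →L[ℝ] Euc (k + 1)) (ξ : Euc (k + 1) → Euc (k + 1))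
    (η : Euc (k + 1) → Euc (k + 1) →L[ℝ] ℝ) (c : ℝ) (f : Euc k → Euc (k + 1)) : Prop where
  sasakian : SasakianOn W G φ ξ η c
  ricci_pos : ∀ y ∈ W, ∀ u, u ≠ 0 → 0 < ricciForm G y u u
  immersion : ImmersionOn U W f
  tangent : ∀ x ∈ U, ∃ u, fderiv ℝ f x u = ξ (f x)
  invariant : ∀ x ∈ U, ∀ ν, IsUnitNormal G f x ν → ∀ u,
    fderiv ℝ f x u ∈ Submodule.span ℝ {ξ (f x), -φ (f x) ν} →
    fderiv ℝ f x (weingarten G f x ν u) ∈ Submodule.span ℝ {ξ (f x), -φ (f x) ν}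
  biharmonic : ∀ x ∈ U, ricciBitension G f x = 0

namespace RicciBiharmonicHopf

variable (B : RicciBiharmonicHopf U W G φ ξ η c f)
include B

theorem mono {U' : Set (Euc k)} (hU' : IsOpen U') (hsub : U' ⊆ U) :
    RicciBiharmonicHopf U' W G φ ξ η c f where
  sasakian := B.sasakian
  ricci_pos := B.ricci_pos
  immersion := B.immersion.mono hU' hsub
  tangent x hx := B.tangent x (hsub hx)
  invariant x hx := B.invariant x (hsub hx)
  biharmonic x hx := B.biharmonic x (hsub hx)

section Pointwise

variable (hx : x ∈ U)
include hx

theorem dim_pos : (0 : ℝ) < k := by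
  have hy := B.immersion.mapsTo x hx
  have hξ := B.ricci_pos _ hy _ (B.sasakian.ξ_ne_zero hy)
  rw [B.sasakian.ricciForm_ξ_ξ hy] at hξ
  push_cast at hξ
  linarith

variable (hpos : ∀ x ∈ U, 0 < meanCurvNorm G f x)
include hpos

omit hx in
theorem reebHypersurface : ReebHypersurface U W G φ ξ η c f (unitMeanCurv G f) where
  sasakian := B.sasakian
  immersion := B.immersion
  normal := B.immersion.normalOn_unitMeanCurv B.sasakian.metric hpos
  tangent := B.tangent

theorem ricciMetricCoeff_pos : 0 < ricciMetricCoeff (k + 1) c := by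
  have X := B.reebHypersurface hpos
  rw [← X.ricciForm_N_N hx]
  exact B.ricci_pos _ (X.mem hx) _ (X.N_ne_zero hx)

theorem deformationOn_ricciForm : DeformationOn W G (ricciForm G) η
    (ricciMetricCoeff (k + 1) c) (ricciContactCoeff (k + 1) c) where
  metric := B.sasakian.riemannianOn_ricciForm B.ricci_pos
  eq _ hy := B.sasakian.ricciForm_eq hy
  α_pos := B.ricciMetricCoeff_pos hx hpos

theorem c_add_three_pos : 0 < c + 3 := by
  have hα := B.ricciMetricCoeff_pos hx hpos
  have hcoeff : (c + 3) * (k + 2) = 4 * ricciMetricCoeff (k + 1) c + 8 := by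
    rw [ricciMetricCoeff]
    push_cast
    ring
  exact pos_of_mul_pos_left (hcoeff ▸ by positivity) (by positivity : (0 : ℝ) ≤ k + 2)

theorem scalarForm_V (w : Euc k) : scalarForm G f (unitMeanCurv G f) x
      (sharp (induced G f) (inducedν G φ f (unitMeanCurv G f)) x) w
    = -inducedη η f x w
      + coeffV (induced G f) (scalarForm G f (unitMeanCurv G f))
          (inducedν G φ f (unitMeanCurv G f)) x
        * inducedν G φ f (unitMeanCurv G f) x w := by
  have X := B.reebHypersurface hpos
  refine X.scalarForm_V hx (B.invariant x hx _ ⟨X.normal.normal x hx, X.normal.norm x hx⟩ _ ?_) w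
  rw [X.fderiv_V hx]
  exact Submodule.subset_span (by simp)

theorem tangential_equation (w : Euc k) :
    scalarForm G f (unitMeanCurv G f) x
        (sharp (induced G f) (fderiv ℝ (meanCurvNorm G f)) x) w
      - ricciContactCoeff (k + 1) c / ricciMetricCoeff (k + 1) c
        * fderiv ℝ (meanCurvNorm G f) x
          (sharp (induced G f) (inducedν G φ f (unitMeanCurv G f)) x) * inducedη η f x w
      = -(k / 2 * meanCurvNorm G f x * fderiv ℝ (meanCurvNorm G f) x w) := by
  have hk := (B.dim_pos hx).ne'
  have hsum : ricciMetricCoeff (k + 1) c + ricciContactCoeff (k + 1) c ≠ 0 := by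
    rw [ricciMetricCoeff_add_ricciContactCoeff]
    push_cast
    rwa [add_sub_cancel_right]
  have hH : meanCurv G f =ᶠ[𝓝 x] fun z => meanCurvNorm G f z • unitMeanCurv G f z :=
    eventually_of_mem (B.immersion.mem_nhds hx) fun z hz =>
      (meanCurvNorm_smul_unitMeanCurv (hpos z hz)).symm
  refine (B.reebHypersurface hpos).tangential_equation (B.deformationOn_ricciForm hx hpos) hx hsum
    (fun x hx => B.immersion.contDiffAt_meanCurvNorm B.sasakian.metric hx (hpos x hx))
    (fun x hx => ?_) ?_ w
  · rw [B.immersion.formTrace_scalarForm_unitMeanCurv B.sasakian.metric hpos hk hx]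
    ring
  · have hbi := B.biharmonic x hx
    rwa [ricciBitension, laplacian, neg_neg, covAlong₂_congr hH, hH.self_of_nhds] at hbi

theorem pseudoHopfData (hne : ∀ x ∈ U, fderiv ℝ (meanCurvNorm G f) x ≠ 0) :
    PseudoHopfData U (induced G f) (scalarForm G f (unitMeanCurv G f)) (inducedΦ G φ f)
      (inducedη η f) (inducedν G φ f (unitMeanCurv G f)) (meanCurvNorm G f) c
      (ricciMetricCoeff (k + 1) c) (ricciContactCoeff (k + 1) c) (k / 2) := by
  have X := B.reebHypersurface hpos
  exact
    { metric := X.induced_metric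
      smooth_b := fun _ hx => X.normal.contDiffAt_scalarForm B.immersion B.sasakian.metric hx
      smooth_η := fun _ hx => X.contDiffAt_inducedη hx
      smooth_ν := fun _ hx => X.contDiffAt_inducedν hx
      smooth_h := fun x hx =>
        B.immersion.contDiffAt_meanCurvNorm B.sasakian.metric hx (hpos x hx)
      b_symm := fun _ hx => X.scalarForm_symm hx
      Φ_skew := fun _ hx => X.inducedΦ_skew hx
      η_V := fun _ hx => X.inducedη_V hx
      ν_V := fun _ hx => X.inducedν_V hx
      η_ζ := fun _ hx => X.inducedη_ζ hx
      Φ_V := fun _ hx => X.inducedΦ_V hx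
      Φ_ζ := fun _ hx => X.inducedΦ_ζ hx
      Φ_nondeg := fun _ hx => X.inducedΦ_nondeg hx
      cov_η := fun _ hx => X.cov_inducedη hx
      cov_ν := fun _ hx => X.cov_inducedν hx
      b_ζ := fun _ hx => X.scalarForm_ζ hx
      b_V := fun _ hx => B.scalarForm_V hx hpos
      codazzi := fun _ hx => X.codazzi hx
      tangential := fun _ hx => B.tangential_equation hx hpos
      h_pos := hpos
      h_ne := hne
      α_pos := B.ricciMetricCoeff_pos hx hpos
      r_pos := half_pos (B.dim_pos hx)
      c_pos := B.c_add_three_pos hx hpos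
      add_eq := by
        rw [ricciMetricCoeff_add_ricciContactCoeff]
        push_cast
        ring }

end Pointwise

theorem eq_empty (hpos : ∀ x ∈ U, 0 < meanCurvNorm G f x)
    (hne : ∀ x ∈ U, fderiv ℝ (meanCurvNorm G f) x ≠ 0) : U = ∅ :=
  Set.eq_empty_of_forall_notMem fun _ hx =>
    Set.notMem_empty _ ((B.pseudoHopfData hx hpos hne).eq_empty ▸ hx)

variable (hx : x ∈ U)
include hx

/- Unlike `|H|`, its square is smooth on all of `U`. Its critical points include the zeros of `H`,
so the complement of its critical set is a hypersurface to which `eq_empty` applies. -/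
theorem fderiv_inner_meanCurv :
    fderiv ℝ (fun z => G (f z) (meanCurv G f z) (meanCurv G f z)) x = 0 := by
  have hG := B.sasakian.metric
  set s : Euc k → ℝ := fun z => G (f z) (meanCurv G f z) (meanCurv G f z)
  have hcont : ContinuousOn (fderiv ℝ s) U := fun z hz =>
    ((B.immersion.contDiffAt_inner_meanCurv hG hz).fderiv_right
      (m := 0) (by simp)).continuousAt.continuousWithinAt
  by_contra hne
  have B' := B.mono (hcont.isOpen_inter_preimage B.immersion.isOpen
    (isOpen_compl_singleton (x := (0 : Euc k →L[ℝ] ℝ))))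
    Set.inter_subset_left
  have hempty := B'.eq_empty
    (fun z hz => B.immersion.meanCurvNorm_pos hG hz.1 hz.2)
    (fun z hz => B.immersion.fderiv_meanCurvNorm_ne_zero hG hz.1 hz.2)
  exact Set.notMem_empty x (hempty ▸ ⟨hx, hne⟩)

theorem meanCurvNorm_eventuallyEq : meanCurvNorm G f =ᶠ[𝓝 x] fun _ => meanCurvNorm G f x := by
  refine meanCurvNorm_eventuallyEq_of_inner ?_
  set s : Euc k → ℝ := fun z => G (f z) (meanCurv G f z) (meanCurv G f z)
  have hdiff : DifferentiableOn ℝ s U := fun z hz =>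
    ((B.immersion.contDiffAt_inner_meanCurv B.sasakian.metric hz).differentiableAt
      (by simp)).differentiableWithinAt
  have hopen := B.immersion.isOpen.isOpen_inter_preimage_of_fderiv_eq_zero hdiff
    (fun _ hz => B.fderiv_inner_meanCurv hz) {s x}
  exact eventually_of_mem (hopen.mem_nhds ⟨hx, rfl⟩) fun _ hz => hz.2

end RicciBiharmonicHopf

end Local

/-! ### From manifolds to coordinates -/

section Charts

variable {n : ℕ} {N : Type*} [TopologicalSpace N] [ChartedSpace (Euc n) N]

theorem extChartAt_symm_mem_baseSet [IsManifold (𝓡 n) 1 N] {x₀ : N} {y : Euc n}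
    (hy : y ∈ (extChartAt (𝓡 n) x₀).target) :
    (extChartAt (𝓡 n) x₀).symm y ∈ (trivializationAt (Euc n)
      (fun x : N => TangentSpace (𝓡 n) x) x₀).baseSet := by
  simpa using (extChartAt (𝓡 n) x₀).map_target hy

variable [IsManifold (𝓡 n) ∞ N]

theorem contDiffAt_comp_extChartAt_symm {x₀ : N} {y : Euc n}
    (hy : y ∈ (extChartAt (𝓡 n) x₀).target)
    {E : Type*} [NormedAddCommGroup E] [NormedSpace ℝ E] {s : N → E}
    (hs : ContMDiffAt (𝓡 n) 𝓘(ℝ, E) ∞ s ((extChartAt (𝓡 n) x₀).symm y)) :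
    ContDiffAt ℝ ∞ (fun z => s ((extChartAt (𝓡 n) x₀).symm z)) y := by
  rw [← contMDiffAt_iff_contDiffAt]
  exact hs.comp y
    ((contMDiffOn_extChartAt_symm x₀).contMDiffAt ((isOpen_extChartAt_target x₀).mem_nhds hy))

namespace AlmostContactMetric

section Frame

variable {x₀ : N} {y : Euc n} (hy : y ∈ (extChartAt (𝓡 n) x₀).target)
include hy

theorem coframe_frame (u : Euc n) : coframe x₀ y (frame x₀ y u) = u := by
  have hcomp := mfderiv_extChartAt_comp_mfderivWithin_extChartAt_symm (I := 𝓡 n) hy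
  rw [ModelWithCorners.range_eq_univ, mfderivWithin_univ] at hcomp
  exact congrArg (fun L : Euc n →L[ℝ] Euc n => L u) hcomp

theorem frame_coframe (v : TangentSpace (𝓡 n) ((extChartAt (𝓡 n) x₀).symm y)) :
    frame x₀ y (coframe x₀ y v) = v := by
  have hcomp := mfderivWithin_extChartAt_symm_comp_mfderiv_extChartAt (I := 𝓡 n) hy
  rw [ModelWithCorners.range_eq_univ, mfderivWithin_univ] at hcomp
  exact congrArg (fun L : Euc n →L[ℝ] Euc n => L v) hcomp

theorem frame_ne_zero {u : Euc n} (hu : u ≠ 0) : frame x₀ y u ≠ 0 := fun h =>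
  hu (by rw [← coframe_frame hy u, h, map_zero])

theorem frame_eq_symmL : frame x₀ y = (trivializationAt (Euc n)
    (fun x : N => TangentSpace (𝓡 n) x) x₀).symmL ℝ ((extChartAt (𝓡 n) x₀).symm y) := by
  have hsymmL := TangentBundle.symmL_trivializationAt (I := 𝓡 n)
    (extChartAt_source (𝓡 n) x₀ ▸ (extChartAt (𝓡 n) x₀).map_target hy)
  rw [ModelWithCorners.range_eq_univ, mfderivWithin_univ,
    (extChartAt (𝓡 n) x₀).right_inv hy] at hsymmL
  exact hsymmL.symm

theorem coframe_eq_continuousLinearMapAt : coframe x₀ y = (trivializationAt (Euc n)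
    (fun x : N => TangentSpace (𝓡 n) x) x₀).continuousLinearMapAt ℝ
      ((extChartAt (𝓡 n) x₀).symm y) :=
  (TangentBundle.continuousLinearMapAt_trivializationAt (I := 𝓡 n)
    (extChartAt_source (𝓡 n) x₀ ▸ (extChartAt (𝓡 n) x₀).map_target hy)).symm

end Frame

variable (S : AlmostContactMetric n N) {x₀ : N} {y : Euc n}

theorem locG_apply (u v : Euc n) : S.locG x₀ y u v
    = S.g.inner ((extChartAt (𝓡 n) x₀).symm y) (frame x₀ y u) (frame x₀ y v) := rfl

section Smooth

variable (hy : y ∈ (extChartAt (𝓡 n) x₀).target)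
include hy

theorem contDiffAt_locξ : ContDiffAt ℝ ∞ (S.locξ x₀) y := by
  have hsection := (Bundle.Trivialization.contMDiffAt_section_iff
    (trivializationAt (Euc n) (fun x : N => TangentSpace (𝓡 n) x) x₀)
    (extChartAt_symm_mem_baseSet hy)).1 (S.ξ.contMDiff ((extChartAt (𝓡 n) x₀).symm y))
  refine (contDiffAt_comp_extChartAt_symm hy hsection).congr_of_eventuallyEq ?_
  filter_upwards [(isOpen_extChartAt_target x₀).mem_nhds hy] with z hz
  rw [locξ, coframe_eq_continuousLinearMapAt hz,
    Bundle.Trivialization.continuousLinearMapAt_apply_of_mem _ _ (extChartAt_symm_mem_baseSet hz)]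

theorem contDiffAt_locφ : ContDiffAt ℝ ∞ (S.locφ x₀) y := by
  have hsection := (Bundle.Trivialization.contMDiffAt_section_iff
    (trivializationAt (Euc n →L[ℝ] Euc n)
      (fun x : N => TangentSpace (𝓡 n) x →L[ℝ] TangentSpace (𝓡 n) x) x₀)
    (by simpa using (extChartAt (𝓡 n) x₀).map_target hy)).1
    (S.φ.contMDiff ((extChartAt (𝓡 n) x₀).symm y))
  refine (contDiffAt_comp_extChartAt_symm hy hsection).congr_of_eventuallyEq ?_
  filter_upwards [(isOpen_extChartAt_target x₀).mem_nhds hy] with z hz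
  rw [hom_trivializationAt_apply, locφ, coframe_eq_continuousLinearMapAt hz, frame_eq_symmL hz]
  rfl

theorem contDiffAt_locG : ContDiffAt ℝ ∞ (S.locG x₀) y := by
  have hsection := (Bundle.Trivialization.contMDiffAt_section_iff
    (trivializationAt (Euc n →L[ℝ] Euc n →L[ℝ] ℝ)
      (fun x : N => TangentSpace (𝓡 n) x →L[ℝ] TangentSpace (𝓡 n) x →L[ℝ] ℝ) x₀)
    (by simpa using (extChartAt (𝓡 n) x₀).map_target hy)).1
    (S.g.contMDiff ((extChartAt (𝓡 n) x₀).symm y))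
  refine (contDiffAt_comp_extChartAt_symm hy hsection).congr_of_eventuallyEq ?_
  filter_upwards [(isOpen_extChartAt_target x₀).mem_nhds hy] with z hz
  ext u v
  have hframe : ∀ u, frame x₀ z u = (trivializationAt (Euc n)
      (fun x : N => TangentSpace (𝓡 n) x) x₀).symm ((extChartAt (𝓡 n) x₀).symm z) u := fun u => by
    rw [frame_eq_symmL hz]
    exact Bundle.Trivialization.symmL_apply _ (extChartAt_symm_mem_baseSet hz) u
  have hcoordinates := inCoordinates_apply_eq₂ (𝕜 := ℝ) (F₁ := Euc n) (F₂ := Euc n) (F₃ := ℝ)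
    (E₁ := fun x : N => TangentSpace (𝓡 n) x) (E₂ := fun x : N => TangentSpace (𝓡 n) x)
    (E₃ := Bundle.Trivial N ℝ) (ϕ := S.g.inner ((extChartAt (𝓡 n) x₀).symm z)) (v := u) (w := v)
    (extChartAt_symm_mem_baseSet hz) (extChartAt_symm_mem_baseSet hz) (by simp)
  rw [hom_trivializationAt_apply, locG_apply, hframe, hframe]
  refine Eq.trans ?_ hcoordinates.symm
  simp

end Smooth

theorem riemannianOn_locG : RiemannianOn (extChartAt (𝓡 n) x₀).target (S.locG x₀) where
  isOpen := isOpen_extChartAt_target x₀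
  smooth _ hy := S.contDiffAt_locG hy
  inner _ hy :=
    { symm := fun _ _ => S.g.symm _ _ _
      pos := fun _ hu => S.g.pos _ _ (frame_ne_zero hy hu) }

theorem IsSasakianSpaceForm.sasakianOn {c : ℝ} (hS : S.IsSasakianSpaceForm c) (x₀ : N) :
    SasakianOn (extChartAt (𝓡 n) x₀).target (S.locG x₀) (S.locφ x₀) (S.locξ x₀) (S.locη x₀) c where
  metric := S.riemannianOn_locG
  smooth_φ y hy := S.contDiffAt_locφ hy
  smooth_ξ y hy := S.contDiffAt_locξ hy
  φ_φ y hy u := by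
    simp only [locφ, locη, locξ, ContinuousLinearMap.comp_apply]
    rw [frame_coframe hy, S.φ_φ, map_add, map_neg, map_smul, coframe_frame hy]
  η_ξ y hy := by
    simp only [locη, locξ, ContinuousLinearMap.comp_apply]
    rw [frame_coframe hy, S.η_ξ]
  φ_ξ y hy := by
    simp only [locφ, locξ, ContinuousLinearMap.comp_apply]
    rw [frame_coframe hy, S.φ_ξ, map_zero]
  η_eq y hy u := by
    rw [locG_apply]
    simp only [locη, locξ, ContinuousLinearMap.comp_apply]
    rw [frame_coframe hy, S.η_eq]
  G_φ_φ y hy u v := by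
    rw [locG_apply, locG_apply]
    simp only [locη, locφ, ContinuousLinearMap.comp_apply]
    rw [frame_coframe hy, frame_coframe hy, S.g_φ_φ]
  sasaki y hy := hS.sasaki x₀ y hy
  curv y hy := hS.curv x₀ y hy

theorem locξ_extChartAt {q : N} (hq : q ∈ (extChartAt (𝓡 n) x₀).source) :
    S.locξ x₀ (extChartAt (𝓡 n) x₀ q)
      = mfderiv (𝓡 n) 𝓘(ℝ, Euc n) (extChartAt (𝓡 n) x₀) q (S.ξ q) := by
  have hcongr : ∀ q' : N, q' = q →
      (mfderiv (𝓡 n) 𝓘(ℝ, Euc n) (extChartAt (𝓡 n) x₀) q' (S.ξ q') : Euc n)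
        = mfderiv (𝓡 n) 𝓘(ℝ, Euc n) (extChartAt (𝓡 n) x₀) q (S.ξ q) := by
    rintro _ rfl
    rfl
  exact hcongr _ ((extChartAt (𝓡 n) x₀).left_inv hq)

end AlmostContactMetric

open AlmostContactMetric

section Immersion

variable {k : ℕ} {M : Type*} [TopologicalSpace M] [ChartedSpace (Euc k) M] {ψ : M → N}

omit [IsManifold (𝓡 n) ∞ N] in
theorem isOpen_locDomain (hψ : Continuous ψ) (p₀ : M) : IsOpen (locDomain k n ψ p₀) :=
  (continuousOn_extChartAt_symm p₀).isOpen_inter_preimage (isOpen_extChartAt_target p₀)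
    ((isOpen_extChartAt_source (ψ p₀)).preimage hψ)

omit [IsManifold (𝓡 n) ∞ N] in
theorem extChartAt_mem_locDomain (p₀ : M) : extChartAt (𝓡 k) p₀ p₀ ∈ locDomain k n ψ p₀ :=
  ⟨mem_extChartAt_target p₀, by simp⟩

variable [IsManifold (𝓡 k) ∞ M]

theorem fderiv_locMap (hψ : MDifferentiable (𝓡 k) (𝓡 n) ψ) {p₀ : M} {x : Euc k}
    (hx : x ∈ locDomain k n ψ p₀) (u : Euc k) :
    fderiv ℝ (locMap k n ψ p₀) x u
      = mfderiv (𝓡 n) 𝓘(ℝ, Euc n) (extChartAt (𝓡 n) (ψ p₀)) (ψ ((extChartAt (𝓡 k) p₀).symm x))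
        (mfderiv (𝓡 k) (𝓡 n) ψ ((extChartAt (𝓡 k) p₀).symm x) (frame p₀ x u)) := by
  have hsymm : MDifferentiableAt 𝓘(ℝ, Euc k) (𝓡 k) (extChartAt (𝓡 k) p₀).symm x := by
    have hwithin := mdifferentiableWithinAt_extChartAt_symm (I := 𝓡 k) hx.1
    rwa [ModelWithCorners.range_eq_univ, mdifferentiableWithinAt_univ] at hwithin
  have hchart : MDifferentiableAt (𝓡 n) 𝓘(ℝ, Euc n) (extChartAt (𝓡 n) (ψ p₀))
      (ψ ((extChartAt (𝓡 k) p₀).symm x)) :=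
    mdifferentiableAt_extChartAt (extChartAt_source (𝓡 n) (ψ p₀) ▸ hx.2)
  have hcomp := (hchart.hasMFDerivAt.comp x ((hψ _).hasMFDerivAt.comp x hsymm.hasMFDerivAt)).mfderiv
  rw [← mfderiv_eq_fderiv]
  exact congrArg (fun L : Euc k →L[ℝ] Euc n => L u) hcomp

theorem IsSmoothImmersion.immersionOn_locMap (hψ : IsSmoothImmersion k n ψ) (p₀ : M) :
    ImmersionOn (locDomain k n ψ p₀) (extChartAt (𝓡 n) (ψ p₀)).target (locMap k n ψ p₀) where
  isOpen := isOpen_locDomain hψ.1.continuous p₀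
  mapsTo _ hx := (extChartAt (𝓡 n) (ψ p₀)).map_source hx.2
  smooth _ hx := contDiffAt_comp_extChartAt_symm (s := fun p => extChartAt (𝓡 n) (ψ p₀) (ψ p))
    hx.1 ((contMDiffAt_extChartAt' (extChartAt_source (𝓡 n) (ψ p₀) ▸ hx.2)).comp _ (hψ.1 _))
  injective x hx u v huv := by
    have hdiff := hψ.1.mdifferentiable (by simp)
    rw [fderiv_locMap hdiff hx, fderiv_locMap hdiff hx] at huv
    have hframe : frame p₀ x u = frame p₀ x v :=
      hψ.2 _ ((isInvertible_mfderiv_extChartAt (I := 𝓡 n) hx.2).injective huv)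
    rw [← coframe_frame hx.1 u, hframe, coframe_frame hx.1]

end Immersion

section Hypersurface

variable {k : ℕ} {N : Type*} [TopologicalSpace N] [ChartedSpace (Euc (k + 1)) N]
  [IsManifold (𝓡 (k + 1)) ∞ N] {S : AlmostContactMetric (k + 1) N}
  {M : Type*} [TopologicalSpace M] [ChartedSpace (Euc k) M] [IsManifold (𝓡 k) ∞ M] {ψ : M → N}

theorem IsPseudoHopf.exists_fderiv_locMap_eq_locξ (hHopf : IsPseudoHopf (k := k) S ψ)
    (hψ : MDifferentiable (𝓡 k) (𝓡 (k + 1)) ψ) {p₀ : M} {x : Euc k}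
    (hx : x ∈ locDomain k (k + 1) ψ p₀) :
    ∃ u, fderiv ℝ (locMap k (k + 1) ψ p₀) x u
      = S.locξ (ψ p₀) (locMap k (k + 1) ψ p₀ x) := by
  obtain ⟨v, hv⟩ := hHopf.tangent ((extChartAt (𝓡 k) p₀).symm x)
  refine ⟨coframe p₀ x v, ?_⟩
  rw [fderiv_locMap hψ hx, frame_coframe hx.1, hv]
  exact (S.locξ_extChartAt hx.2).symm

theorem ricciBiharmonicHopf_locMap {c : ℝ} (hS : S.IsSasakianSpaceForm c) (hRic : S.RicciIsMetric)
    (hψ : IsSmoothImmersion k (k + 1) ψ) (hHopf : IsPseudoHopf (k := k) S ψ)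
    (hbi : IsRicciBiharmonic (k := k) S ψ) (p₀ : M) :
    RicciBiharmonicHopf (locDomain k (k + 1) ψ p₀) (extChartAt (𝓡 (k + 1)) (ψ p₀)).target
      (S.locG (ψ p₀)) (S.locφ (ψ p₀)) (S.locξ (ψ p₀)) (S.locη (ψ p₀)) c
      (locMap k (k + 1) ψ p₀) where
  sasakian := hS.sasakianOn S (ψ p₀)
  ricci_pos := hRic (ψ p₀)
  immersion := hψ.immersionOn_locMap p₀
  tangent _ hx := hHopf.exists_fderiv_locMap_eq_locξ (hψ.1.mdifferentiable (by simp)) hx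
  invariant := hHopf.invariant p₀
  biharmonic := hbi p₀

theorem GradIsPrincipal.not_meanCurvNorm_eventuallyEq (hgrad : GradIsPrincipal (k := k) S ψ)
    (hψ : IsSmoothImmersion k (k + 1) ψ) {p₀ : M} {x : Euc k}
    (hx : x ∈ locDomain k (k + 1) ψ p₀) :
    ¬ meanCurvNorm (S.locG (ψ p₀)) (locMap k (k + 1) ψ p₀)
      =ᶠ[𝓝 x] fun _ => meanCurvNorm (S.locG (ψ p₀)) (locMap k (k + 1) ψ p₀) x := fun hconst => by
  obtain ⟨ν, hν⟩ := (hψ.immersionOn_locMap p₀).exists_isUnitNormal S.riemannianOn_locG hx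
  obtain ⟨_, -, hne⟩ := hgrad p₀ x hx ν hν
  exact hne (gradMeanCurvNorm_eq_zero hconst)

end Hypersurface

end Charts

end RicciBiharmonic

theorem mainTheorem2_general {k : ℕ} {c : ℝ} {N : Type*} [TopologicalSpace N]
    [ChartedSpace (RicciBiharmonic.Euc (k + 1)) N] [IsManifold (𝓡 (k + 1)) ∞ N]
    {S : RicciBiharmonic.AlmostContactMetric (k + 1) N}
    (hS : S.IsSasakianSpaceForm c) (hRic : S.RicciIsMetric)
    {M : Type*} [TopologicalSpace M] [ChartedSpace (RicciBiharmonic.Euc k) M]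
    [IsManifold (𝓡 k) ∞ M] {ψ : M → N} (hψ : RicciBiharmonic.IsSmoothImmersion k (k + 1) ψ)
    (hHopf : RicciBiharmonic.IsPseudoHopf (k := k) S ψ)
    (hbi : RicciBiharmonic.IsRicciBiharmonic (k := k) S ψ)
    (p₀ : M) {x : RicciBiharmonic.Euc k} (hx : x ∈ RicciBiharmonic.locDomain k (k + 1) ψ p₀) :
    RicciBiharmonic.meanCurvNorm (S.locG (ψ p₀)) (RicciBiharmonic.locMap k (k + 1) ψ p₀)
      =ᶠ[nhds x] fun _ => RicciBiharmonic.meanCurvNorm (S.locG (ψ p₀))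
        (RicciBiharmonic.locMap k (k + 1) ψ p₀) x :=
  (RicciBiharmonic.ricciBiharmonicHopf_locMap hS hRic hψ hHopf hbi p₀).meanCurvNorm_eventuallyEq hx

theorem mainTheorem2 (m : ℕ) (c : ℝ)
    {N : Type*} [TopologicalSpace N] [ChartedSpace (RicciBiharmonic.Euc (2 * m + 1)) N]
    [IsManifold (𝓡 (2 * m + 1)) ∞ N]
    (S : RicciBiharmonic.AlmostContactMetric (2 * m + 1) N)
    (hS : S.IsSasakianSpaceForm c) (hRic : S.RicciIsMetric)
    {M : Type*} [TopologicalSpace M] [ChartedSpace (RicciBiharmonic.Euc (2 * m)) M]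
    [IsManifold (𝓡 (2 * m)) ∞ M] [Nonempty M]
    (ψ : M → N) (hψ : RicciBiharmonic.IsSmoothImmersion (2 * m) (2 * m + 1) ψ) :
    ¬ (RicciBiharmonic.IsPseudoHopf (k := 2 * m) S ψ ∧
      RicciBiharmonic.IsRicciBiharmonic (k := 2 * m) S ψ ∧
      RicciBiharmonic.GradIsPrincipal (k := 2 * m) S ψ) := by
  rintro ⟨hHopf, hbi, hgrad⟩
  obtain ⟨p₀⟩ := ‹Nonempty M›
  have hx := RicciBiharmonic.extChartAt_mem_locDomain (k := 2 * m) (n := 2 * m + 1) (ψ := ψ) p₀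
  exact hgrad.not_meanCurvNorm_eventuallyEq hψ hx
    (mainTheorem2_general hS hRic hψ hHopf hbi p₀ hx)
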